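/- \textbf{Setting.} Let $M\ge 0$, let $\mathfrak h$ be a complex vector space of dimension $2M$ with a nondegenerate symmetric bilinear form $(\cdot,\cdot)$, and let $\mathfrak h=\mathfrak p\oplus\mathfrak q$ with $\mathfrak p,\mathfrak q$ maximal isotropic. Put $\hat{\mathfrak h}_{\mathbb Z+1/2}=\mathfrak h\otimes t^{1/2}\mathbb C[t,t^{-1}]\oplus\mathbb C\mathbf k$, and let $N(\hat{\mathfrak h}_{\mathbb Z+1/2})$ be the quotient of the tensor algebra of $\hat{\mathfrak h}_{\mathbb Z+1/2}$ by the two-sided ideal generated by $$(a\otimes t^{m+\frac12})\otimes(b\otimes t^{n+\frac12})+(b\otimes t^{n+\frac12})\otimes(a\otimes t^{m+\frac12})-(a,b)\,\delta_{m+n+1,0}\,\mathbf k ,\qquad (a\otimes t^{k+\frac12})\otimes\mathbf k-\mathbf k\otimes(a\otimes t^{k+\frac12}),$$ for $a,b\in\mathfrak h$ and integers $m\ge 0$, $n<0$, $k$. Fix $\ell\in\mathbb C$. Let $V$ be the $N(\hat{\mathfrak h}_{\mathbb Z+1/2})$-module induced from the one-dimensional module $\mathbb C\mathbf 1$ of the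 subalgebra generated by $\mathbf k$ and all $a\otimes t^{m+1/2}$, $m\ge0$, on which $\mathbf k$ acts as $\ell$ and every $a\otimes t^{m+1/2}$, $m\ge 0$, acts as $0$. Write $a(n+\frac12)$ for the action of $a\otimes t^{n+1/2}$ on $V$. For $k\in\frac12\mathbb Z$ let $V_{(k)}$ be the span of the vectors $h_1(-m_1-\frac12)\cdots h_r(-m_r-\frac12)\mathbf 1$ ($r\ge 0$, $h_i\in\mathfrak h$, $m_i\in\mathbb N$) with $m_1+\cdots+m_r+\frac r2=k$. The normal ordering is $:\!h_1(n_1+\tfrac12)\cdots h_r(n_r+\tfrac12)\!:\;=(-1)^\sigma h_{\sigma(1)}(n_{\sigma(1)}+\tfrac12)\cdots h_{\sigma(r)}(n_{\sigma(r)}+\tfrac12)$, where $\sigma$ is the permutation that puts the negative modes ($n_i<0$) to the left of the positive modes ($n_i\ge 0$) and keeps the order within each of the two groups, and $(-1)^\sigma$ is its sign. Let $Y\colon V\otimes V\to V((x))$ be the unique linear map such that for all $r\ge 0$, $h_i\in\mathfrak h$, $m_i\in\mathbb N$ $$Y\big(h_1(-m_1-\tfrac12)\cdots h_r(-m_r-\tfrac12)\mathbf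 1,x\big)=\sum_{n_1,\dots,n_r\in\mathbb Z}\ \prod_{i=1}^r\binom{-n_i-1}{m_i}\; :\!h_1(n_1+\tfrac12)\cdots h_r(n_r+\tfrac12)\!:\;x^{\sum_i(-n_i-m_i-1)}$$ (so $Y(\mathbf 1,x)=1_V$). \textbf{Theorem.} $(V,Y,\mathbf 1)$ is a $\frac{\mathbb Z}2$-graded meromorphic open-string vertex algebra, that is: \begin{enumerate} \item $V=\coprod_{k\in\frac12\mathbb Z}V_{(k)}$; $V_{(k)}=0$ for $k$ sufficiently negative; $Y(u,x)v\in V((x))$ for all $u,v\in V$; and, with $\mathbf d$ the operator equal to $k$ on $V_{(k)}$, $[\mathbf d,Y(v,x)]=x\frac{d}{dx}Y(v,x)+Y(\mathbf d v,x)$ for all $v\in V$. \item $Y(\mathbf 1,x)=1_V$; and for all $u\in V$, $Y(u,x)\mathbf 1\in V[[x]]$ with $\lim_{x\to0}Y(u,x)\mathbf 1=u$. \item With $Dv=\lim_{x\to 0}\frac{d}{dx}Y(v,x)\mathbf 1$, one has $\frac{d}{dx}Y(v,x)=Y(Dv,x)=[D,Y(v,x)]$ for all $v\in V$. \item For all $u_1,v\in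 V$ there is $p\in\mathbb N$ such that for every $u_2\in V$ $$(x_0+x_2)^pY(u_1,x_0+x_2)Y(u_2,x_2)v=(x_0+x_2)^pY(Y(u_1,x_0)u_2,x_2)v$$ as formal series in $x_0,x_2$, where powers of $x_0+x_2$ are expanded in nonnegative powers of $x_2$. \end{enumerate} -/

import Mathlib

noncomputable section

namespace FermionicMOSVA

/-! ### Half-integer graded meromorphic open-string vertex algebras

A formal series `∑ₙ fₙ xⁿ ∈ V[[x, x⁻¹]]` is the function `f : ℤ → V` of its coefficients, and a
series `∑ f_{a,b} x₀ᵃ x₂ᵇ` is a function `ℤ → ℤ → V`. -/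

section MOSVA

variable {V : Type*} [AddCommGroup V] [Module ℂ V]

/-- The operator `d` of a graded space `V = ∐ V_(k/2)`, where `A k` is `V_(k/2)`: it is the
linear map which is multiplication by `k/2` on `A k`. -/
def weightOp (A : ℤ → Submodule ℂ V) (hA : DirectSum.IsInternal A) : V →ₗ[ℂ] V :=
  (DirectSum.toModule ℂ ℤ V (fun k => ((k : ℂ) / 2) • (A k).subtype)) ∘ₗ
    (LinearEquiv.ofBijective (DirectSum.coeLinearMap A) hA).symm.toLinearMap

/-- The formal derivative `d/dx`. -/
def formalDeriv (f : ℤ → V) : ℤ → V := fun n => (n + 1) • f (n + 1)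

/-- The map `v ↦ lim_{x → 0} (d/dx) Y(v, x) 𝟏`, i.e. `v` goes to the constant term of
`(d/dx) Y(v, x) 𝟏`. -/
def derivOp (Y : V →ₗ[ℂ] V →ₗ[ℂ] (ℤ → V)) (one : V) (v : V) : V := formalDeriv (Y v one) 0

/-- `(x₀ + x₂)ᵖ f(x₀, x₂)`. -/
def mulAddPow (p : ℕ) (f : ℤ → ℤ → V) : ℤ → ℤ → V :=
  fun a b => ∑ j ∈ Finset.range (p + 1), p.choose j • f (a - (p - j : ℕ)) (b - j)

/-- `Y(u₁, x₀ + x₂) Y(u₂, x₂) v`, where every power of `x₀ + x₂` is expanded in nonnegative powers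
of `x₂`: `(x₀ + x₂)ⁿ = ∑_{i ≥ 0} (n choose i) x₀ⁿ⁻ⁱ x₂ⁱ`. The sum over `i` is finite as soon as
`Y(u₂, x) v` has only finitely many negative powers of `x`. -/
def productSeries (Y : V →ₗ[ℂ] V →ₗ[ℂ] (ℤ → V)) (u₁ u₂ v : V) : ℤ → ℤ → V :=
  fun a b => ∑ᶠ i : ℕ, Ring.choose (a + (i : ℤ)) i • Y u₁ (Y u₂ v (b - i)) (a + i)

/-- `Y(Y(u₁, x₀) u₂, x₂) v`. -/
def iterateSeries (Y : V →ₗ[ℂ] V →ₗ[ℂ] (ℤ → V)) (u₁ u₂ v : V) : ℤ → ℤ → V :=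
  fun a b => Y (Y u₁ u₂ a) v b

/-- `(V, Y, one)` with the grading `V_(k/2) = A k`, `k ∈ ℤ`, is a `ℤ/2`-graded meromorphic
open-string vertex algebra; `Y u v n` is the coefficient of `xⁿ` in `Y(u, x) v`. -/
structure IsMOSVA (A : ℤ → Submodule ℂ V) (Y : V →ₗ[ℂ] V →ₗ[ℂ] (ℤ → V)) (one : V) : Prop where
  /-- `V` is the direct sum of the `V_(k/2)`. -/
  grading : DirectSum.IsInternal A
  /-- Lower bound condition. -/
  lower_bound : ∃ N : ℤ, ∀ k < N, A k = ⊥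
  /-- `Y(u, x) v ∈ V((x))` (a consequence of the other grading axioms, recorded because it makes
  the products of series below well defined). -/
  truncation : ∀ u v : V, ∃ N : ℤ, ∀ n < N, Y u v n = 0
  /-- `[d, Y(v, x)] = x (d/dx) Y(v, x) + Y(d v, x)`. -/
  d_commutator : ∀ (v w : V) (n : ℤ),
    weightOp A grading (Y v w n) - Y v (weightOp A grading w) n
      = n • Y v w n + Y (weightOp A grading v) w n
  /-- `Y(𝟏, x) = 1_V`. -/
  identity : ∀ w : V, Y one w = Pi.single 0 w
  /-- `Y(u, x) 𝟏 ∈ V[[x]]` and its limit at `x = 0` is `u`. -/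
  creation : ∀ u : V, (∀ n < 0, Y u one n = 0) ∧ Y u one 0 = u
  /-- `(d/dx) Y(v, x) = Y(D v, x)`. -/
  D_derivative : ∀ v w : V, formalDeriv (Y v w) = Y (derivOp Y one v) w
  /-- `(d/dx) Y(v, x) = [D, Y(v, x)]`. -/
  D_commutator : ∀ (v w : V) (n : ℤ),
    formalDeriv (Y v w) n = derivOp Y one (Y v w n) - Y v (derivOp Y one w) n
  /-- Weak associativity with pole-order condition: `p` depends on `u₁` and `v` only. -/
  weak_associativity : ∀ u₁ v : V, ∃ p : ℕ, ∀ u₂ : V,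
    mulAddPow p (productSeries Y u₁ u₂ v) = mulAddPow p (iterateSeries Y u₁ u₂ v)

end MOSVA

/-! ### The algebra `N` and the induced module `V` -/

/-- A subspace on which the form vanishes and which is maximal with this property. -/
def IsMaximalIsotropic {𝔥 : Type*} [AddCommGroup 𝔥] [Module ℂ 𝔥] (B : LinearMap.BilinForm ℂ 𝔥)
    (𝔭 : Submodule ℂ 𝔥) : Prop :=
  Maximal (fun 𝔰 : Submodule ℂ 𝔥 => ∀ a ∈ 𝔰, ∀ b ∈ 𝔰, B a b = 0) 𝔭

/-- The half-integral affinization `𝔥 ⊗ t^{1/2} ℂ[t, t⁻¹] ⊕ ℂ 𝐤`; the pair `(f, c)` stands for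
`∑ₙ f n ⊗ t^{n + 1/2} + c 𝐤`. -/
abbrev Affinization (𝔥 : Type*) [AddCommGroup 𝔥] [Module ℂ 𝔥] : Type _ := (ℤ →₀ 𝔥) × ℂ

section Fock

variable {𝔥 : Type*} [AddCommGroup 𝔥] [Module ℂ 𝔥]

/-- `a ⊗ t^{n + 1/2}` in the tensor algebra of the affinization. -/
def tGen (a : 𝔥) (n : ℤ) : TensorAlgebra ℂ (Affinization 𝔥) :=
  TensorAlgebra.ι ℂ ((Finsupp.single n a, 0) : Affinization 𝔥)

/-- `𝐤` in the tensor algebra of the affinization. -/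
def tCentral (𝔥 : Type*) [AddCommGroup 𝔥] [Module ℂ 𝔥] : TensorAlgebra ℂ (Affinization 𝔥) :=
  TensorAlgebra.ι ℂ ((0, 1) : Affinization 𝔥)

/-- The defining relations of `N`. There is none between two generators `a ⊗ t^{m + 1/2}`,
`b ⊗ t^{n + 1/2}` whose exponents have the same sign. -/
inductive Rel (B : LinearMap.BilinForm ℂ 𝔥) :
    TensorAlgebra ℂ (Affinization 𝔥) → TensorAlgebra ℂ (Affinization 𝔥) → Prop
  | anticomm (a b : 𝔥) (m n : ℤ) (hm : 0 ≤ m) (hn : n < 0) :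
      Rel B (tGen a m * tGen b n + tGen b n * tGen a m)
        (if m + n + 1 = 0 then B a b • tCentral 𝔥 else 0)
  | central (a : 𝔥) (n : ℤ) : Rel B (tGen a n * tCentral 𝔥) (tCentral 𝔥 * tGen a n)

/-- The algebra `N`: the tensor algebra modulo the two-sided ideal generated by the relations. -/
abbrev FermionAlg (B : LinearMap.BilinForm ℂ 𝔥) : Type _ := RingQuot (Rel B)

/-- The class of `a ⊗ t^{n + 1/2}` in `N`. -/
def gen (B : LinearMap.BilinForm ℂ 𝔥) (a : 𝔥) (n : ℤ) : FermionAlg B :=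
  RingQuot.mkAlgHom ℂ (Rel B) (tGen a n)

/-- The class of `𝐤` in `N`. -/
def centralGen (B : LinearMap.BilinForm ℂ 𝔥) : FermionAlg B :=
  RingQuot.mkAlgHom ℂ (Rel B) (tCentral 𝔥)

/-- The left ideal of `N` generated by all `a ⊗ t^{m + 1/2}` with `m ≥ 0` and by `𝐤 - ℓ`. -/
def vacuumIdeal (B : LinearMap.BilinForm ℂ 𝔥) (ℓ : ℂ) : Submodule (FermionAlg B) (FermionAlg B) :=
  Submodule.span (FermionAlg B)
    ({x | ∃ (a : 𝔥) (m : ℤ), 0 ≤ m ∧ x = gen B a m} ∪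
      {centralGen B - algebraMap ℂ (FermionAlg B) ℓ})

/-- The module induced to `N` from the one-dimensional module `ℂ 𝟏` of the subalgebra generated by
the `a ⊗ t^{m + 1/2}`, `m ≥ 0`, and `𝐤`, where the `a ⊗ t^{m + 1/2}` act by zero and `𝐤` acts by the
scalar `ℓ`: inducing a cyclic module `S ⧸ I` of a subalgebra `S ⊆ N` gives `N ⧸ N I`. -/
def Fock (B : LinearMap.BilinForm ℂ 𝔥) (ℓ : ℂ) : Type _ := FermionAlg B ⧸ vacuumIdeal B ℓ

variable (B : LinearMap.BilinForm ℂ 𝔥) (ℓ : ℂ)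

instance : AddCommGroup (Fock B ℓ) :=
  inferInstanceAs (AddCommGroup (FermionAlg B ⧸ vacuumIdeal B ℓ))

instance : Module (FermionAlg B) (Fock B ℓ) :=
  inferInstanceAs (Module (FermionAlg B) (FermionAlg B ⧸ vacuumIdeal B ℓ))

instance : Module ℂ (Fock B ℓ) :=
  inferInstanceAs (Module ℂ (FermionAlg B ⧸ vacuumIdeal B ℓ))

instance : IsScalarTower ℂ (FermionAlg B) (Fock B ℓ) :=
  inferInstanceAs (IsScalarTower ℂ (FermionAlg B) (FermionAlg B ⧸ vacuumIdeal B ℓ))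

/-- The quotient map `N → V`, `n ↦ n 𝟏`. -/
def Fock.mk : FermionAlg B →ₗ[FermionAlg B] Fock B ℓ := (vacuumIdeal B ℓ).mkQ

/-- The vacuum `𝟏`. -/
def vac : Fock B ℓ := Fock.mk B ℓ 1

/-- The mode `a(n + 1/2)`: the action of `a ⊗ t^{n + 1/2}` on `V`. -/
def mode (a : 𝔥) (n : ℤ) : Module.End ℂ (Fock B ℓ) :=
  Algebra.lsmul ℂ ℂ (Fock B ℓ) (gen B a n)

/-- The vector `h₁(-m₁ - 1/2) ⋯ h_r(-m_r - 1/2) 𝟏`. -/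
def monomial {r : ℕ} (h : Fin r → 𝔥) (m : Fin r → ℕ) : Fock B ℓ :=
  (List.ofFn fun i => mode B ℓ (h i) (-(m i : ℤ) - 1)).prod (vac B ℓ)

/-- The weight space `V_(k/2)`: the span of the `h₁(-m₁ - 1/2) ⋯ h_r(-m_r - 1/2) 𝟏` with
`m₁ + ⋯ + m_r + r/2 = k/2`. -/
def weightSpace (k : ℤ) : Submodule ℂ (Fock B ℓ) :=
  Submodule.span ℂ {v | ∃ (r : ℕ) (h : Fin r → 𝔥) (m : Fin r → ℕ),
    (2 * ∑ i, (m i : ℤ)) + r = k ∧ v = monomial B ℓ h m}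

/-! ### Normal ordering and the vertex operators -/

/-- The permutation `σ` which puts the indices `i` with `n i + 1/2 < 0` first and those with
`n i + 1/2 > 0` last, and is increasing on each of these two blocks. -/
def shuffle {r : ℕ} (n : Fin r → ℤ) : Equiv.Perm (Fin r) :=
  Tuple.sort fun i => if n i < 0 then (0 : ℕ) else 1

/-- The fermionic normal ordering `:h₁(n₁ + 1/2) ⋯ h_r(n_r + 1/2):`. -/
def nord {r : ℕ} (h : Fin r → 𝔥) (n : Fin r → ℤ) : Module.End ℂ (Fock B ℓ) :=
  (Equiv.Perm.sign (shuffle n) : ℤ) •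
    (List.ofFn fun i => mode B ℓ (h (shuffle n i)) (n (shuffle n i))).prod

/-- The coefficient of `xᵏ` in `:h₁^{(m₁)}(x) ⋯ h_r^{(m_r)}(x): w`, where
`h^{(m)}(x) = ∑ₙ (-n-1 choose m) h(n + 1/2) x^{-n-m-1}`. By `nordSeries_finite` only finitely many
terms of the sum are nonzero. -/
def nordSeries {r : ℕ} (h : Fin r → 𝔥) (m : Fin r → ℕ) (w : Fock B ℓ) (k : ℤ) : Fock B ℓ :=
  ∑ᶠ (n : Fin r → ℤ) (_ : ∑ i, (-n i - m i - 1) = k),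
    (∏ i, Ring.choose (-n i - 1) (m i)) • nord B ℓ h n w


/-! ### Well-definedness of the vertex operators

The rest of this part proves that there is one and only one bilinear map `Y` with the prescribed
values on the vectors `h₁(-m₁ - 1/2) ⋯ h_r(-m_r - 1/2) 𝟏`. -/

lemma gen_anticomm (a b : 𝔥) (m n : ℤ) (hm : 0 ≤ m) (hn : n < 0) :
    gen B a m * gen B b n + gen B b n * gen B a m
      = if m + n + 1 = 0 then B a b • centralGen B else 0 := by
  have h := RingQuot.mkAlgHom_rel ℂ (Rel.anticomm (B := B) a b m n hm hn)
  rw [map_add, map_mul, map_mul] at h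
  rw [gen, gen, h]
  split_ifs
  · rw [map_smul]; rfl
  · rw [map_zero]

lemma gen_central (a : 𝔥) (n : ℤ) : gen B a n * centralGen B = centralGen B * gen B a n := by
  have h := RingQuot.mkAlgHom_rel ℂ (Rel.central (B := B) a n)
  rwa [map_mul, map_mul] at h

lemma gen_add (a b : 𝔥) (n : ℤ) : gen B (a + b) n = gen B a n + gen B b n := by
  have : ((Finsupp.single n (a + b), 0) : Affinization 𝔥)
      = (Finsupp.single n a, 0) + (Finsupp.single n b, 0) := by simp
  simp only [gen, tGen, this, map_add]

lemma gen_smul (c : ℂ) (a : 𝔥) (n : ℤ) : gen B (c • a) n = c • gen B a n := by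
  have : ((Finsupp.single n (c • a), 0) : Affinization 𝔥)
      = c • ((Finsupp.single n a, 0) : Affinization 𝔥) := by simp
  simp only [gen, tGen, this, map_smul]

lemma mode_apply (a : 𝔥) (n : ℤ) (v : Fock B ℓ) : mode B ℓ a n v = gen B a n • v := rfl

/-- The mode `a(n + 1/2)` as a linear function of `a`. -/
def modeL (n : ℤ) : 𝔥 →ₗ[ℂ] Module.End ℂ (Fock B ℓ) where
  toFun a := mode B ℓ a n
  map_add' a b := by rw [mode, gen_add, map_add]; rfl
  map_smul' c a := by rw [mode, gen_smul, map_smul]; rfl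

lemma smul_vac (n : FermionAlg B) : n • vac B ℓ = Fock.mk B ℓ n := by
  rw [vac, ← map_smul, smul_eq_mul, mul_one]

lemma gen_vac (a : 𝔥) (m : ℤ) (hm : 0 ≤ m) : gen B a m • vac B ℓ = 0 := by
  rw [smul_vac]
  exact (Submodule.Quotient.mk_eq_zero _).2 (Submodule.subset_span (Or.inl ⟨a, m, hm, rfl⟩))

lemma central_vac : centralGen B • vac B ℓ = ℓ • vac B ℓ := by
  rw [← algebraMap_smul (FermionAlg B) ℓ (vac B ℓ), ← sub_eq_zero, ← sub_smul, smul_vac]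
  exact (Submodule.Quotient.mk_eq_zero _).2 (Submodule.subset_span (Or.inr rfl))

/-! The tensor algebra of `⨁_{m ≥ 0} 𝔥`, whose `m`-th summand stands for `𝔥 ⊗ t^{-m - 1/2}`. -/

/-- `𝔥 ⊗ t^{-1/2} ℂ[t⁻¹]`. -/
abbrev Neg (𝔥 : Type*) [AddCommGroup 𝔥] [Module ℂ 𝔥] : Type _ := DirectSum ℕ (fun _ => 𝔥)

lemma tensor_left_induction {W : Type*} [AddCommGroup W] [Module ℂ W]
    (p : Submodule ℂ (TensorAlgebra ℂ W)) (h1 : 1 ∈ p)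
    (hι : ∀ w, ∀ x ∈ p, TensorAlgebra.ι ℂ w * x ∈ p) (x : TensorAlgebra ℂ W) : x ∈ p := by
  have key : ∀ y ∈ p, x * y ∈ p := by
    induction x using TensorAlgebra.induction with
    | algebraMap c =>
      intro y hy; rw [← Algebra.smul_def]; exact p.smul_mem _ hy
    | ι w => exact fun y hy => hι w y hy
    | mul a b ha hb => intro y hy; rw [mul_assoc]; exact ha _ (hb _ hy)
    | add a b ha hb => intro y hy; rw [add_mul]; exact p.add_mem (ha _ hy) (hb _ hy)
  simpa using key 1 h1

/-- Auxiliary to `contract`. -/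
def contractStep {W : Type*} [AddCommGroup W] [Module ℂ W] (f : W →ₗ[ℂ] ℂ) :
    W →ₗ[ℂ] Module.End ℂ (TensorAlgebra ℂ W × TensorAlgebra ℂ W) where
  toFun w := LinearMap.prod
    (LinearMap.mulLeft ℂ (TensorAlgebra.ι ℂ w) ∘ₗ LinearMap.fst ℂ _ _)
    (f w • LinearMap.fst ℂ _ _ - LinearMap.mulLeft ℂ (TensorAlgebra.ι ℂ w) ∘ₗ LinearMap.snd ℂ _ _)
  map_add' a b := by
    refine LinearMap.ext fun x => Prod.ext ?_ ?_
    · simp [add_mul]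
    · simp [add_mul, add_smul]; abel
  map_smul' c a := by
    refine LinearMap.ext fun x => Prod.ext ?_ ?_
    · simp
    · simp [smul_sub, mul_smul]

/-- The contraction with `f`: the odd derivation of the tensor algebra extending `f`. -/
def contract {W : Type*} [AddCommGroup W] [Module ℂ W] (f : W →ₗ[ℂ] ℂ) :
    Module.End ℂ (TensorAlgebra ℂ W) :=
  LinearMap.snd ℂ _ _ ∘ₗ LinearMap.applyₗ ((1, 0) : TensorAlgebra ℂ W × TensorAlgebra ℂ W) ∘ₗ
    (TensorAlgebra.lift ℂ (contractStep f)).toLinearMap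

section contract

variable {W : Type*} [AddCommGroup W] [Module ℂ W]

lemma contract_one (f : W →ₗ[ℂ] ℂ) : contract f 1 = 0 := by
  simp [contract]

lemma lift_contractStep_fst (f : W →ₗ[ℂ] ℂ) (x : TensorAlgebra ℂ W)
    (y : TensorAlgebra ℂ W × TensorAlgebra ℂ W) :
    (TensorAlgebra.lift ℂ (contractStep f) x y).1 = x * y.1 := by
  induction x using TensorAlgebra.induction generalizing y with
  | algebraMap c => simp [Algebra.smul_def]
  | ι w => simp [contractStep]
  | mul a b ha hb => rw [map_mul, Module.End.mul_apply, ha, hb, mul_assoc]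
  | add a b ha hb => rw [map_add, LinearMap.add_apply, Prod.fst_add, ha, hb, add_mul]

lemma contract_ι_mul (f : W →ₗ[ℂ] ℂ) (w : W) (x : TensorAlgebra ℂ W) :
    contract f (TensorAlgebra.ι ℂ w * x) = f w • x - TensorAlgebra.ι ℂ w * contract f x := by
  have h := lift_contractStep_fst f x (1, 0)
  have h' : contract f (TensorAlgebra.ι ℂ w * x)
      = (contractStep f w (TensorAlgebra.lift ℂ (contractStep f) x (1, 0))).2 := by
    simp [contract]
  rw [h']
  change f w • (TensorAlgebra.lift ℂ (contractStep f) x (1, 0)).1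
    - TensorAlgebra.ι ℂ w * contract f x = _
  rw [h, mul_one]

lemma contract_add (f g : W →ₗ[ℂ] ℂ) : contract (f + g) = contract f + contract g := by
  refine LinearMap.ext fun x => ?_
  refine tensor_left_induction (LinearMap.eqLocus (contract (f + g)) (contract f + contract g))
    ?_ ?_ x
  · simp [LinearMap.mem_eqLocus, contract_one]
  · intro w y hy
    rw [LinearMap.mem_eqLocus] at hy ⊢
    simp only [LinearMap.add_apply, contract_ι_mul] at hy ⊢
    rw [hy, add_smul, mul_add]; abel

lemma contract_smul (c : ℂ) (f : W →ₗ[ℂ] ℂ) : contract (c • f) = c • contract f := by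
  refine LinearMap.ext fun x => ?_
  refine tensor_left_induction (LinearMap.eqLocus (contract (c • f)) (c • contract f)) ?_ ?_ x
  · simp [LinearMap.mem_eqLocus, contract_one]
  · intro w y hy
    rw [LinearMap.mem_eqLocus] at hy ⊢
    simp only [LinearMap.smul_apply, contract_ι_mul] at hy ⊢
    rw [hy, smul_sub, smul_eq_mul, mul_smul, mul_smul_comm]

end contract

/-- `ξ ↦ ℓ (a, ξ_m)`. -/
def pairing (a : 𝔥) (m : ℕ) : Neg 𝔥 →ₗ[ℂ] ℂ := ℓ • (B a ∘ₗ DirectSum.component ℂ ℕ (fun _ => 𝔥) m)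

/-- The action of `a ⊗ t^{n + 1/2}` on the tensor algebra. -/
def tensorMode (n : ℤ) : 𝔥 →ₗ[ℂ] Module.End ℂ (TensorAlgebra ℂ (Neg 𝔥)) where
  toFun a := if n < 0 then LinearMap.mulLeft ℂ
      (TensorAlgebra.ι ℂ (DirectSum.lof ℂ ℕ (fun _ => 𝔥) (-n - 1).toNat a))
    else contract (pairing B ℓ a n.toNat)
  map_add' a b := by
    split_ifs
    · refine LinearMap.ext fun x => ?_
      simp [add_mul]
    · rw [← contract_add, pairing, pairing, pairing, map_add, LinearMap.add_comp, smul_add]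
  map_smul' c a := by
    split_ifs
    · refine LinearMap.ext fun x => ?_
      simp
    · rw [RingHom.id_apply, ← contract_smul, pairing, pairing, map_smul, LinearMap.smul_comp,
        smul_comm]

lemma tensorMode_neg {n : ℤ} (hn : n < 0) (a : 𝔥) (x : TensorAlgebra ℂ (Neg 𝔥)) :
    tensorMode B ℓ n a x
      = TensorAlgebra.ι ℂ (DirectSum.lof ℂ ℕ (fun _ => 𝔥) (-n - 1).toNat a) * x := by
  simp [tensorMode, hn]

lemma tensorMode_pos {n : ℤ} (hn : 0 ≤ n) (a : 𝔥) :
    tensorMode B ℓ n a = contract (pairing B ℓ a n.toNat) := by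
  simp [tensorMode, not_lt.2 hn]

/-- The action of the affinization on the tensor algebra. -/
def tensorAction : Affinization 𝔥 →ₗ[ℂ] Module.End ℂ (TensorAlgebra ℂ (Neg 𝔥)) :=
  (Finsupp.lsum ℂ (tensorMode B ℓ)).coprod (LinearMap.toSpanSingleton ℂ _ (ℓ • 1))

lemma lift_tGen (a : 𝔥) (n : ℤ) :
    TensorAlgebra.lift ℂ (tensorAction B ℓ) (tGen a n) = tensorMode B ℓ n a := by
  simp [tGen, tensorAction]

lemma lift_tCentral : TensorAlgebra.lift ℂ (tensorAction B ℓ) (tCentral 𝔥) = ℓ • 1 := by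
  simp [tCentral, tensorAction]

/-- The representation of `N` on the tensor algebra. -/
def rep : FermionAlg B →ₐ[ℂ] Module.End ℂ (TensorAlgebra ℂ (Neg 𝔥)) :=
  RingQuot.liftAlgHom ℂ ⟨TensorAlgebra.lift ℂ (tensorAction B ℓ), by
    intro x y hxy
    cases hxy with
    | anticomm a b m n hm hn =>
      refine LinearMap.ext fun x => ?_
      rw [map_add, map_mul, map_mul, lift_tGen, lift_tGen, LinearMap.add_apply,
        Module.End.mul_apply, Module.End.mul_apply, tensorMode_neg B ℓ hn, tensorMode_neg B ℓ hn,
        tensorMode_pos B ℓ hm, contract_ι_mul, sub_add_cancel]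
      split_ifs with h
      · have h' : (-n - 1).toNat = m.toNat := by omega
        rw [map_smul, lift_tCentral, h', pairing, smul_smul, LinearMap.smul_apply,
          LinearMap.smul_apply, LinearMap.comp_apply, DirectSum.component.lof_self, smul_eq_mul,
          mul_comm]
        rfl
      · have h' : (-n - 1).toNat ≠ m.toNat := by omega
        rw [map_zero, pairing, LinearMap.smul_apply, LinearMap.comp_apply, DirectSum.component.of,
          dif_neg h', map_zero, smul_zero, zero_smul]
        rfl
    | central a n =>
      rw [map_mul, map_mul, lift_tCentral]
      simp⟩

lemma rep_gen (a : 𝔥) (n : ℤ) : rep B ℓ (gen B a n) = tensorMode B ℓ n a := by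
  rw [rep, gen, RingQuot.liftAlgHom_mkAlgHom_apply, lift_tGen]

lemma rep_central : rep B ℓ (centralGen B) = ℓ • 1 := by
  rw [rep, centralGen, RingQuot.liftAlgHom_mkAlgHom_apply, lift_tCentral]

/-- The map from `N` to the tensor algebra given by the action on `1`. -/
def repOne : FermionAlg B →ₛₗ[(rep B ℓ).toRingHom] TensorAlgebra ℂ (Neg 𝔥) where
  toFun n := rep B ℓ n 1
  map_add' x y := by rw [map_add]; rfl
  map_smul' x y := by rw [smul_eq_mul, map_mul]; rfl

/-- The map from `V` to the tensor algebra. -/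
def toTensor : Fock B ℓ →ₛₗ[(rep B ℓ).toRingHom] TensorAlgebra ℂ (Neg 𝔥) :=
  (vacuumIdeal B ℓ).liftQ (repOne B ℓ) (by
    rw [vacuumIdeal, Submodule.span_le]
    rintro x (⟨a, m, hm, rfl⟩ | rfl)
    · change rep B ℓ (gen B a m) 1 = 0
      rw [rep_gen, tensorMode_pos B ℓ hm, contract_one]
    · change rep B ℓ _ 1 = 0
      rw [map_sub, rep_central, AlgHom.commutes]
      simp [Algebra.algebraMap_eq_smul_one])

lemma toTensor_smul (x : FermionAlg B) (v : Fock B ℓ) :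
    toTensor B ℓ (x • v) = rep B ℓ x (toTensor B ℓ v) :=
  (toTensor B ℓ).map_smulₛₗ x v

lemma toTensor_vac : toTensor B ℓ (vac B ℓ) = 1 := by
  change rep B ℓ 1 1 = 1
  rw [map_one (rep B ℓ)]; rfl

/-- The inclusion of `𝔥 ⊗ t^{-1/2} ℂ[t⁻¹]` in `N`. -/
def negGen : Neg 𝔥 →ₗ[ℂ] FermionAlg B :=
  DirectSum.toModule ℂ ℕ _ fun m =>
    { toFun := fun a => gen B a (-(m : ℤ) - 1)
      map_add' := fun a b => gen_add B a b _
      map_smul' := fun c a => gen_smul B c a _ }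

lemma negGen_lof (m : ℕ) (a : 𝔥) :
    negGen B (DirectSum.lof ℂ ℕ (fun _ => 𝔥) m a) = gen B a (-(m : ℤ) - 1) := by
  simp [negGen]

/-- The map from the tensor algebra to `V`. -/
def ofTensor : TensorAlgebra ℂ (Neg 𝔥) →ₗ[ℂ] Fock B ℓ :=
  (LinearMap.toSpanSingleton (FermionAlg B) (Fock B ℓ) (vac B ℓ)).restrictScalars ℂ ∘ₗ
    (TensorAlgebra.lift ℂ (negGen B)).toLinearMap

lemma ofTensor_one : ofTensor B ℓ 1 = vac B ℓ := by
  simp [ofTensor]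

lemma ofTensor_ι_mul (w : Neg 𝔥) (x : TensorAlgebra ℂ (Neg 𝔥)) :
    ofTensor B ℓ (TensorAlgebra.ι ℂ w * x) = negGen B w • ofTensor B ℓ x := by
  simp [ofTensor, mul_smul]

lemma central_negGen (w : Neg 𝔥) : centralGen B * negGen B w = negGen B w * centralGen B := by
  induction w using DirectSum.induction_on with
  | zero => simp
  | of m a =>
    have := negGen_lof B m a
    rw [DirectSum.lof_eq_of] at this
    rw [this, gen_central]
  | add x y hx hy => rw [map_add, mul_add, add_mul, hx, hy]

lemma gen_negGen (a : 𝔥) (n : ℕ) (w : Neg 𝔥) :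
    gen B a n * negGen B w + negGen B w * gen B a n
      = B a (DirectSum.component ℂ ℕ (fun _ => 𝔥) n w) • centralGen B := by
  induction w using DirectSum.induction_on with
  | zero => simp
  | of m b =>
    rw [← DirectSum.lof_eq_of ℂ, negGen_lof, gen_anticomm B a b n _ (by omega) (by omega)]
    by_cases h : m = n
    · subst h
      rw [if_pos (by ring), DirectSum.component.lof_self]
    · rw [if_neg (by omega), DirectSum.component.of, dif_neg h]
      simp
  | add x y hx hy =>
    rw [map_add, mul_add, add_mul, map_add, map_add, add_smul, ← hx, ← hy]; abel

lemma central_ofTensor (x : TensorAlgebra ℂ (Neg 𝔥)) :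
    centralGen B • ofTensor B ℓ x = ℓ • ofTensor B ℓ x := by
  refine tensor_left_induction (LinearMap.eqLocus
    (Algebra.lsmul ℂ ℂ (Fock B ℓ) (centralGen B) ∘ₗ ofTensor B ℓ) (ℓ • ofTensor B ℓ)) ?_ ?_ x
  · simp [LinearMap.mem_eqLocus, ofTensor_one, central_vac]
  · intro w y hy
    simp only [LinearMap.mem_eqLocus, LinearMap.comp_apply, Algebra.lsmul_coe,
      LinearMap.smul_apply, ofTensor_ι_mul] at hy ⊢
    rw [← mul_smul, central_negGen, mul_smul, hy, smul_comm]

lemma gen_ofTensor (a : 𝔥) (n : ℤ) (x : TensorAlgebra ℂ (Neg 𝔥)) :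
    gen B a n • ofTensor B ℓ x = ofTensor B ℓ (tensorMode B ℓ n a x) := by
  rcases lt_or_ge n 0 with hn | hn
  · rw [tensorMode_neg B ℓ hn, ofTensor_ι_mul, negGen_lof]
    congr 2
    omega
  · rw [tensorMode_pos B ℓ hn]
    refine tensor_left_induction (LinearMap.eqLocus
      (Algebra.lsmul ℂ ℂ (Fock B ℓ) (gen B a n) ∘ₗ ofTensor B ℓ)
      (ofTensor B ℓ ∘ₗ contract (pairing B ℓ a n.toNat))) ?_ ?_ x
    · simp [LinearMap.mem_eqLocus, ofTensor_one, contract_one, gen_vac B ℓ a n hn]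
    · intro w y hy
      simp only [LinearMap.mem_eqLocus, LinearMap.comp_apply, Algebra.lsmul_coe, ofTensor_ι_mul,
        contract_ι_mul, map_sub, map_smul] at hy ⊢
      rw [← hy, eq_sub_iff_add_eq, ← mul_smul, ← mul_smul, ← add_smul]
      lift n to ℕ using hn
      rw [gen_negGen, Int.toNat_natCast, smul_assoc, central_ofTensor, pairing]
      simp [smul_smul, mul_comm]

lemma smul_ofTensor (n : FermionAlg B) (x : TensorAlgebra ℂ (Neg 𝔥)) :
    n • ofTensor B ℓ x = ofTensor B ℓ (rep B ℓ n x) := by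
  obtain ⟨t, rfl⟩ := RingQuot.mkAlgHom_surjective ℂ (Rel B) n
  induction t using TensorAlgebra.induction generalizing x with
  | algebraMap c => simp
  | ι w =>
    rw [rep, RingQuot.liftAlgHom_mkAlgHom_apply, TensorAlgebra.lift_ι_apply]
    obtain ⟨f, c⟩ := w
    have hdec : ((f, c) : Affinization 𝔥) = (f, 0) + c • (0, 1) := by simp
    have hc : RingQuot.mkAlgHom ℂ (Rel B) (TensorAlgebra.ι ℂ ((0, 1) : Affinization 𝔥))
        = centralGen B := rfl
    rw [hdec, map_add, map_add, map_smul, map_smul, map_add, map_smul, hc, add_smul, smul_assoc,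
      central_ofTensor, LinearMap.add_apply, map_add]
    congr 1
    · induction f using Finsupp.induction_linear with
      | zero =>
        have : ((0, 0) : Affinization 𝔥) = 0 := rfl
        simp [this]
      | single n a =>
        have h := gen_ofTensor B ℓ a n x
        rw [gen, tGen] at h
        rw [h]
        simp [tensorAction]
      | add f g hf hg =>
        have : ((f + g, 0) : Affinization 𝔥) = (f, 0) + (g, 0) := by simp
        rw [this, map_add, map_add, map_add, add_smul,
          hf (by simp), hg (by simp), LinearMap.add_apply, map_add]
    · simp [tensorAction]
  | mul a b ha hb => rw [map_mul, map_mul, mul_smul, hb, ha]; rfl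
  | add a b ha hb => rw [map_add, map_add, add_smul, ha, hb, ← map_add]; rfl

lemma toTensor_ofTensor (x : TensorAlgebra ℂ (Neg 𝔥)) : toTensor B ℓ (ofTensor B ℓ x) = x := by
  refine tensor_left_induction
    { carrier := {x | toTensor B ℓ (ofTensor B ℓ x) = x}
      add_mem' := ?_
      zero_mem' := ?_
      smul_mem' := ?_ } ?_ ?_ x
  · intro x y hx hy
    simp only [Set.mem_ofPred_eq] at hx hy ⊢
    rw [map_add, map_add (toTensor B ℓ), hx, hy]
  · change toTensor B ℓ (ofTensor B ℓ 0) = 0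
    rw [map_zero, map_zero (toTensor B ℓ)]
  · intro c x hx
    simp only [Set.mem_ofPred_eq] at hx ⊢
    rw [map_smul, ← algebraMap_smul (FermionAlg B) c, toTensor_smul, hx, AlgHom.commutes]
    rfl
  · exact (congrArg _ (ofTensor_one B ℓ)).trans (toTensor_vac B ℓ)
  · intro w y hy
    change toTensor B ℓ (ofTensor B ℓ y) = y at hy
    change toTensor B ℓ (ofTensor B ℓ _) = _
    rw [ofTensor_ι_mul, toTensor_smul, hy]
    clear hy
    induction w using DirectSum.induction_on with
    | zero => simp
    | of m a =>
      rw [← DirectSum.lof_eq_of ℂ, negGen_lof, rep_gen, tensorMode_neg B ℓ (by omega)]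
      have hm : (-(-(m : ℤ) - 1) - 1).toNat = m := by omega
      rw [hm]
    | add u v hu hv => rw [map_add, map_add, LinearMap.add_apply, hu, hv, map_add, add_mul]

lemma ofTensor_surjective : Function.Surjective (ofTensor B ℓ) := by
  intro v
  obtain ⟨n, rfl⟩ := (vacuumIdeal B ℓ).mkQ_surjective v
  refine ⟨rep B ℓ n 1, ?_⟩
  rw [← smul_ofTensor, ofTensor_one, smul_vac]
  rfl

/-- The linear isomorphism between the tensor algebra of `𝔥 ⊗ t^{-1/2} ℂ[t⁻¹]` and `V`. -/
def tensorEquiv : TensorAlgebra ℂ (Neg 𝔥) ≃ₗ[ℂ] Fock B ℓ :=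
  LinearEquiv.ofBijective (ofTensor B ℓ)
    ⟨Function.LeftInverse.injective (toTensor_ofTensor B ℓ), ofTensor_surjective B ℓ⟩

lemma ofTensor_tprod {r : ℕ} (h : Fin r → 𝔥) (m : Fin r → ℕ) :
    ofTensor B ℓ (TensorAlgebra.tprod ℂ (Neg 𝔥) r fun i => DirectSum.lof ℂ ℕ (fun _ => 𝔥) (m i) (h i))
      = monomial B ℓ h m := by
  rw [TensorAlgebra.tprod_apply, monomial]
  induction r with
  | zero => simp [ofTensor_one]
  | succ r ih =>
    rw [List.ofFn_succ, List.ofFn_succ, List.prod_cons, List.prod_cons, ofTensor_ι_mul,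
      Module.End.mul_apply, negGen_lof, mode_apply]
    congr 1
    exact ih (fun i => h i.succ) (fun i => m i.succ)

lemma mode_monomial {r : ℕ} (a : 𝔥) (n : ℕ) (h : Fin r → 𝔥) (m : Fin r → ℕ) :
    mode B ℓ a (-(n : ℤ) - 1) (monomial B ℓ h m)
      = monomial B ℓ (Fin.cons a h : Fin (r + 1) → 𝔥) (Fin.cons n m : Fin (r + 1) → ℕ) := by
  simp [monomial, List.ofFn_succ, List.prod_cons, Module.End.mul_apply]

/-- `V` is spanned by the `h₁(-m₁ - 1/2) ⋯ h_r(-m_r - 1/2) 𝟏`. -/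
theorem span_monomial : Submodule.span ℂ
    {v | ∃ (r : ℕ) (h : Fin r → 𝔥) (m : Fin r → ℕ), v = monomial B ℓ h m} = ⊤ := by
  refine eq_top_iff.2 fun v _ => ?_
  obtain ⟨x, rfl⟩ := ofTensor_surjective B ℓ v
  refine tensor_left_induction (Submodule.comap (ofTensor B ℓ) (Submodule.span ℂ
    {v | ∃ (r : ℕ) (h : Fin r → 𝔥) (m : Fin r → ℕ), v = monomial B ℓ h m})) ?_ ?_ x
  · rw [Submodule.mem_comap, ofTensor_one]
    exact Submodule.subset_span ⟨0, Fin.elim0, Fin.elim0, by simp [monomial]⟩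
  · intro w y hy
    rw [Submodule.mem_comap] at hy ⊢
    rw [ofTensor_ι_mul]
    induction w using DirectSum.induction_on with
    | zero => rw [map_zero, zero_smul]; exact Submodule.zero_mem _
    | of n a =>
      rw [← DirectSum.lof_eq_of ℂ, negGen_lof, ← mode_apply]
      refine Submodule.span_induction ?_ ?_ ?_ ?_ hy
      · rintro _ ⟨r, h, m, rfl⟩
        rw [mode_monomial]
        exact Submodule.subset_span ⟨_, _, _, rfl⟩
      · rw [map_zero]; exact Submodule.zero_mem _
      · intro u v _ _ hu hv
        rw [map_add]; exact Submodule.add_mem _ hu hv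
      · intro c u _ hu
        rw [map_smul]; exact Submodule.smul_mem _ _ hu
    | add u v hu hv => rw [map_add, add_smul]; exact Submodule.add_mem _ hu hv

lemma mode_anticomm (a b : 𝔥) (m : ℤ) (hm : 0 ≤ m) (n : ℕ) (v : Fock B ℓ) :
    mode B ℓ a m (mode B ℓ b (-(n : ℤ) - 1) v)
      = (if m = n then (ℓ * B a b) • v else 0) - mode B ℓ b (-(n : ℤ) - 1) (mode B ℓ a m v) := by
  have h := congrArg (· • v) (gen_anticomm B a b m (-(n : ℤ) - 1) hm (by omega))
  obtain ⟨x, rfl⟩ := ofTensor_surjective B ℓ v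
  simp only [add_smul, mul_smul] at h
  rw [mode_apply, mode_apply, mode_apply, mode_apply, eq_sub_iff_add_eq, h]
  by_cases hmn : m = n
  · rw [if_pos (by omega), if_pos hmn, smul_assoc, central_ofTensor, smul_smul, mul_comm]
  · rw [if_neg (by omega), if_neg hmn, zero_smul]

/-- The span of the `h₁(-m₁ - 1/2) ⋯ h_r(-m_r - 1/2) 𝟏` with all `m_i < K`. -/
inductive Bounded (K : ℕ) : Fock B ℓ → Prop
  | vac : Bounded K (vac B ℓ)
  | zero : Bounded K 0
  | neg (b : 𝔥) (j : ℕ) (hj : j < K) (v : Fock B ℓ) (hv : Bounded K v) :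
      Bounded K (mode B ℓ b (-(j : ℤ) - 1) v)
  | add (v w : Fock B ℓ) (hv : Bounded K v) (hw : Bounded K w) : Bounded K (v + w)
  | smul (c : ℂ) (v : Fock B ℓ) (hv : Bounded K v) : Bounded K (c • v)

variable {B ℓ}

lemma Bounded.mono {K L : ℕ} (hKL : K ≤ L) {v : Fock B ℓ} (hv : Bounded B ℓ K v) :
    Bounded B ℓ L v := by
  induction hv with
  | vac => exact .vac
  | zero => exact .zero
  | neg b j hj v _ ih => exact .neg b j (by omega) v ih
  | add v w _ _ ihv ihw => exact .add v w ihv ihw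
  | smul c v _ ih => exact .smul c v ih

lemma exists_bounded (v : Fock B ℓ) : ∃ K, Bounded B ℓ K v := by
  obtain ⟨x, rfl⟩ := ofTensor_surjective B ℓ v
  refine tensor_left_induction
    { carrier := {x | ∃ K, Bounded B ℓ K (ofTensor B ℓ x)}
      add_mem' := ?_
      zero_mem' := ?_
      smul_mem' := ?_ } ?_ ?_ x
  · rintro x y ⟨K, hK⟩ ⟨L, hL⟩
    refine ⟨max K L, ?_⟩
    rw [map_add]
    exact .add _ _ (hK.mono (le_max_left _ _)) (hL.mono (le_max_right _ _))
  · exact ⟨0, by rw [map_zero]; exact .zero⟩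
  · rintro c x ⟨K, hK⟩
    exact ⟨K, by rw [map_smul]; exact .smul c _ hK⟩
  · exact ⟨0, by rw [ofTensor_one]; exact .vac⟩
  · rintro w y ⟨K, hK⟩
    change ∃ K, Bounded B ℓ K (ofTensor B ℓ _)
    rw [ofTensor_ι_mul]
    induction w using DirectSum.induction_on with
    | zero => exact ⟨0, by rw [map_zero, zero_smul]; exact .zero⟩
    | of m a =>
      refine ⟨max K (m + 1), ?_⟩
      rw [← DirectSum.lof_eq_of ℂ, negGen_lof]
      exact .neg a m (by omega) _ (hK.mono (le_max_left _ _))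
    | add u v hu hv =>
      obtain ⟨K, hK⟩ := hu
      obtain ⟨L, hL⟩ := hv
      refine ⟨max K L, ?_⟩
      rw [map_add, add_smul]
      exact .add _ _ (hK.mono (le_max_left _ _)) (hL.mono (le_max_right _ _))

lemma Bounded.mode_pos {K : ℕ} {v : Fock B ℓ} (hv : Bounded B ℓ K v) (a : 𝔥) (n : ℤ) (hn : 0 ≤ n) :
    Bounded B ℓ K (mode B ℓ a n v) ∧ (K ≤ n → mode B ℓ a n v = 0) := by
  induction hv with
  | vac =>
    have h : mode B ℓ a n (FermionicMOSVA.vac B ℓ) = 0 := gen_vac B ℓ a n hn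
    rw [h]; exact ⟨.zero, fun _ => rfl⟩
  | zero => rw [map_zero]; exact ⟨.zero, fun _ => rfl⟩
  | neg b j hj v hv ih =>
    rw [mode_anticomm B ℓ a b n hn]
    constructor
    · rw [sub_eq_add_neg, ← neg_one_smul ℂ]
      refine .add _ _ ?_ (.smul _ _ (.neg b j hj _ ih.1))
      split_ifs
      · exact .smul _ _ hv
      · exact .zero
    · intro hK
      rw [if_neg (by omega), ih.2 hK, map_zero, sub_zero]
  | add v w _ _ ihv ihw =>
    rw [map_add]
    exact ⟨.add _ _ ihv.1 ihw.1, fun h => by rw [ihv.2 h, ihw.2 h, add_zero]⟩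
  | smul c v _ ih =>
    rw [map_smul]
    exact ⟨.smul _ _ ih.1, fun h => by rw [ih.2 h, smul_zero]⟩

lemma Bounded.list_prod {K : ℕ} {v : Fock B ℓ} (hv : Bounded B ℓ K v) (L : List (𝔥 × ℤ))
    (hpos : ∀ x ∈ L, 0 ≤ x.2) : Bounded B ℓ K ((L.map fun x => mode B ℓ x.1 x.2).prod v) := by
  induction L with
  | nil => simpa using hv
  | cons x L ih =>
    rw [List.map_cons, List.prod_cons, Module.End.mul_apply]
    exact ((ih fun y hy => hpos y (List.mem_cons_of_mem _ hy)).mode_pos _ _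
      (hpos x List.mem_cons_self)).1

lemma Bounded.list_prod_eq_zero {K : ℕ} {v : Fock B ℓ} (hv : Bounded B ℓ K v) (L : List (𝔥 × ℤ))
    (hL : L.Pairwise fun x y => 0 ≤ x.2 → 0 ≤ y.2) (hK : ∃ x ∈ L, (K : ℤ) ≤ x.2) :
    (L.map fun x => mode B ℓ x.1 x.2).prod v = 0 := by
  induction L with
  | nil => simp at hK
  | cons x L ih =>
    rw [List.map_cons, List.prod_cons, Module.End.mul_apply]
    rw [List.pairwise_cons] at hL
    obtain ⟨y, hy, hyK⟩ := hK
    rcases List.mem_cons.1 hy with rfl | hy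
    · have h0 : 0 ≤ y.2 := by omega
      exact ((hv.list_prod L fun z hz => hL.1 z hz h0).mode_pos _ _ h0).2 hyK
    · rw [ih hL.2 ⟨y, hy, hyK⟩, map_zero]

lemma Bounded.nord_eq_zero {K : ℕ} {v : Fock B ℓ} (hv : Bounded B ℓ K v) {r : ℕ} (h : Fin r → 𝔥)
    (n : Fin r → ℤ) (i : Fin r) (hi : (K : ℤ) ≤ n i) : nord B ℓ h n v = 0 := by
  have key := hv.list_prod_eq_zero
    (List.ofFn fun i => (h (shuffle n i), n (shuffle n i))) ?_ ?_
  · rw [List.map_ofFn] at key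
    rw [nord, LinearMap.smul_apply]
    exact (congrArg _ key).trans (smul_zero _)
  · rw [List.pairwise_ofFn]
    intro i j hij h0
    have hmono := Tuple.monotone_sort (fun i => if n i < 0 then (0 : ℕ) else 1) hij.le
    by_contra hneg
    simp only [Function.comp_apply] at hmono
    change (if n (shuffle n i) < 0 then (0 : ℕ) else 1)
      ≤ (if n (shuffle n j) < 0 then (0 : ℕ) else 1) at hmono
    rw [if_neg (not_lt.2 h0), if_pos (not_le.1 hneg)] at hmono
    omega
  · refine ⟨_, (List.mem_ofFn' _ _).2 ⟨(shuffle n).symm i, rfl⟩, ?_⟩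
    simpa using hi

variable (B ℓ)

/-- For given `w` and `k` only finitely many terms contribute to the coefficient of `xᵏ` of a
normally ordered product of series applied to `w`. -/
theorem nordSeries_finite {r : ℕ} (h : Fin r → 𝔥) (m : Fin r → ℕ) (w : Fock B ℓ) (k : ℤ) :
    {n : Fin r → ℤ | ∑ i, (-n i - m i - 1) = k ∧ nord B ℓ h n w ≠ 0}.Finite := by
  obtain ⟨K, hK⟩ := exists_bounded w
  set c : ℤ := -k - ∑ i, ((m i : ℤ) + 1) with hc
  refine (Set.finite_Icc (fun _ : Fin r => c - r * K) (fun _ => (K : ℤ))).subset ?_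
  rintro n ⟨hn, hne⟩
  have hlt : ∀ i, n i < K := fun i => by
    by_contra hi
    exact hne (hK.nord_eq_zero h n i (not_lt.1 hi))
  have hsum : ∑ i, n i = c := by
    rw [hc, ← hn, ← Finset.sum_neg_distrib, ← Finset.sum_sub_distrib]
    exact Finset.sum_congr rfl fun i _ => by ring
  refine ⟨fun i => ?_, fun i => (hlt i).le⟩
  have h1 : ∑ j ∈ Finset.univ.erase i, n j ≤ ∑ j ∈ Finset.univ.erase i, (K : ℤ) :=
    Finset.sum_le_sum fun j _ => (hlt j).le
  have h2 := Finset.add_sum_erase Finset.univ n (Finset.mem_univ i)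
  have h3 : ∑ j ∈ Finset.univ.erase i, (K : ℤ) ≤ r * K := by
    refine (Finset.sum_le_sum_of_subset_of_nonneg (Finset.erase_subset i Finset.univ)
      fun _ _ _ => by positivity).trans ?_
    simp
  change c - r * K ≤ n i
  omega

/-- The normal ordering as a multilinear function of `h`. -/
def nordML {r : ℕ} (n : Fin r → ℤ) :
    MultilinearMap ℂ (fun _ : Fin r => 𝔥) (Module.End ℂ (Fock B ℓ)) :=
  (Equiv.Perm.sign (shuffle n) : ℤ) •
    ((MultilinearMap.mkPiAlgebraFin ℂ r (Module.End ℂ (Fock B ℓ))).compLinearMap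
      fun i => modeL B ℓ (n (shuffle n i))).domDomCongr (shuffle n)

lemma nordML_apply {r : ℕ} (n : Fin r → ℤ) (h : Fin r → 𝔥) : nordML B ℓ n h = nord B ℓ h n := by
  simp only [nordML, nord, smul_apply, MultilinearMap.domDomCongr_apply,
    MultilinearMap.compLinearMap_apply, MultilinearMap.mkPiAlgebraFin_apply]
  rfl

lemma nordSeries_add {r : ℕ} (m : Fin r → ℕ) (h₁ h₂ h₃ : Fin r → 𝔥) (w₁ w₂ w₃ : Fock B ℓ) (k : ℤ)
    (H : ∀ n, nord B ℓ h₃ n w₃ = nord B ℓ h₁ n w₁ + nord B ℓ h₂ n w₂) :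
    nordSeries B ℓ h₃ m w₃ k = nordSeries B ℓ h₁ m w₁ k + nordSeries B ℓ h₂ m w₂ k := by
  have fin : ∀ (h : Fin r → 𝔥) (w : Fock B ℓ), ({n : Fin r → ℤ | ∑ i, (-n i - m i - 1) = k} ∩
      Function.support fun n : Fin r → ℤ =>
        (∏ i, Ring.choose (-n i - 1) (m i)) • nord B ℓ h n w).Finite := fun h w =>
    (nordSeries_finite B ℓ h m w k).subset fun n hn => ⟨hn.1, fun h0 => hn.2 (by simp [h0])⟩
  have := finsum_mem_add_distrib' (fin h₁ w₁) (fin h₂ w₂)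
  simp only [nordSeries]
  refine Eq.trans (finsum_congr fun n => finsum_congr fun _ => ?_) this
  rw [H, smul_add]

lemma nordSeries_smul {r : ℕ} (m : Fin r → ℕ) (h₁ h₃ : Fin r → 𝔥) (w₁ w₃ : Fock B ℓ) (k : ℤ) (c : ℂ)
    (H : ∀ n, nord B ℓ h₃ n w₃ = c • nord B ℓ h₁ n w₁) :
    nordSeries B ℓ h₃ m w₃ k = c • nordSeries B ℓ h₁ m w₁ k := by
  simp only [nordSeries, smul_finsum]
  refine finsum_congr fun n => finsum_congr fun _ => ?_
  rw [H, smul_comm]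

/-- The series of a normally ordered product as a multilinear function of `h`. -/
def nordSeriesML {r : ℕ} (m : Fin r → ℕ) :
    MultilinearMap ℂ (fun _ : Fin r => 𝔥) (Fock B ℓ →ₗ[ℂ] (ℤ → Fock B ℓ)) where
  toFun h :=
    { toFun := fun w => nordSeries B ℓ h m w
      map_add' := fun v w => funext fun k => nordSeries_add B ℓ m h h h v w (v + w) k
        fun n => map_add _ _ _
      map_smul' := fun c w => funext fun k => nordSeries_smul B ℓ m h h w (c • w) k c
        fun n => map_smul _ _ _ }
  map_update_add' h i x y := by
    refine LinearMap.ext fun w => funext fun k => nordSeries_add B ℓ m _ _ _ w w w k fun n => ?_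
    simp only [← nordML_apply, MultilinearMap.map_update_add, LinearMap.add_apply]
  map_update_smul' h i c x := by
    refine LinearMap.ext fun w => funext fun k => nordSeries_smul B ℓ m _ _ w w k c fun n => ?_
    simp only [← nordML_apply, MultilinearMap.map_update_smul, LinearMap.smul_apply]

/-- There is a unique bilinear map `Y` such that
`Y(h₁(-m₁ - 1/2) ⋯ h_r(-m_r - 1/2) 𝟏, x) = :h₁^{(m₁)}(x) ⋯ h_r^{(m_r)}(x):`. -/
theorem existsUnique_vertexOp : ∃! Y : Fock B ℓ →ₗ[ℂ] Fock B ℓ →ₗ[ℂ] (ℤ → Fock B ℓ),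
    ∀ (r : ℕ) (h : Fin r → 𝔥) (m : Fin r → ℕ) (w : Fock B ℓ) (k : ℤ),
      Y (monomial B ℓ h m) w k = nordSeries B ℓ h m w k := by
  have he : ∀ (r : ℕ) (h : Fin r → 𝔥) (m : Fin r → ℕ),
      (tensorEquiv B ℓ).symm (monomial B ℓ h m) = TensorAlgebra.tprod ℂ (Neg 𝔥) r
        fun i => DirectSum.lof ℂ ℕ (fun _ => 𝔥) (m i) (h i) := fun r h m => by
    rw [LinearEquiv.symm_apply_eq, ← ofTensor_tprod]; rfl
  let Y₀ : DirectSum ℕ (fun r => TensorPower ℂ r (Neg 𝔥)) →ₗ[ℂ]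
      (Fock B ℓ →ₗ[ℂ] (ℤ → Fock B ℓ)) :=
    DirectSum.toModule ℂ ℕ _ fun r => PiTensorProduct.lift
      (MultilinearMap.fromDirectSumEquiv (κ := fun _ : Fin r => ℕ) (M := fun _ _ => 𝔥)
        fun m => nordSeriesML B ℓ m)
  have key : ∀ (r : ℕ) (h : Fin r → 𝔥) (m : Fin r → ℕ) (w : Fock B ℓ) (k : ℤ),
      (Y₀ ∘ₗ (TensorAlgebra.toDirectSum (R := ℂ) (M := Neg 𝔥)).toLinearMap ∘ₗ
        (tensorEquiv B ℓ).symm.toLinearMap) (monomial B ℓ h m) w k = nordSeries B ℓ h m w k := by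
    intro r h m w k
    simp only [LinearMap.comp_apply, LinearEquiv.coe_coe, he, AlgHom.toLinearMap_apply]
    rw [TensorAlgebra.toDirectSum_tensorPower_tprod]
    simp only [Y₀]
    rw [← DirectSum.lof_eq_of ℂ, DirectSum.toModule_lof, PiTensorProduct.lift.tprod,
      MultilinearMap.fromDirectSumEquiv_lof]
    rfl
  refine ⟨_, key, ?_⟩
  · intro Y hY
    refine LinearMap.ext_on_range (v := fun x : Σ r : ℕ, (Fin r → 𝔥) × (Fin r → ℕ) =>
      monomial B ℓ x.2.1 x.2.2) ?_ ?_
    · rw [← span_monomial B ℓ]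
      congr 1
      ext v
      exact ⟨fun ⟨x, hx⟩ => ⟨x.1, x.2.1, x.2.2, hx.symm⟩,
        fun ⟨r, h, m, hx⟩ => ⟨⟨r, h, m⟩, hx.symm⟩⟩
    · rintro ⟨r, h, m⟩
      refine LinearMap.ext fun w => funext fun k => ?_
      rw [hY, key]

/-- The vertex operator map: `vertexOp B ℓ u v n` is the coefficient of `xⁿ` in `Y(u, x) v`. It is
the bilinear map with
`Y(h₁(-m₁ - 1/2) ⋯ h_r(-m_r - 1/2) 𝟏, x) = :h₁^{(m₁)}(x) ⋯ h_r^{(m_r)}(x):`. -/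
def vertexOp : Fock B ℓ →ₗ[ℂ] Fock B ℓ →ₗ[ℂ] (ℤ → Fock B ℓ) :=
  (existsUnique_vertexOp B ℓ).choose

theorem vertexOp_monomial {r : ℕ} (h : Fin r → 𝔥) (m : Fin r → ℕ) (w : Fock B ℓ) (k : ℤ) :
    vertexOp B ℓ (monomial B ℓ h m) w k = nordSeries B ℓ h m w k :=
  (existsUnique_vertexOp B ℓ).choose_spec.1 r h m w k

end Fock
end FermionicMOSVA
end

noncomputable section

namespace FermionicMOSVA

section Fock

variable {𝔥 : Type*} [AddCommGroup 𝔥] [Module ℂ 𝔥] (B : LinearMap.BilinForm ℂ 𝔥) (ℓ : ℂ)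

/-! ### Induction on vectors, parity and grading -/

/-! Only modes of opposite sign are related in `N`, so `V` is the tensor algebra of the negative
modes. Hence every vector is built from the vacuum by creation operators and linear combinations,
and the axioms on `Y` can be proved by induction on its first argument.

The engine is the recursion `vertexOp_mode`. With P the parity operator it reads Y(a(-m-1/2)u, x) =
∑_{s≥0} C(m+s,m) x^s a(-m-s-1/2) Y(u,x) + ∑_{n≥0} C(-n-1,m) x^{-n-m-1} Y(Pu,x) a(n+1/2). In a
normally ordered product a new leading negative mode stays in front. A new nonnegative mode can be
carried to the far right past all r other factors, at the cost of (-1)^r, because two nonnegative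
modes anticommute as operators on `V` (`mode_anticomm_pos`), although `N` imposes no such relation.

The creation property and the commutators with `d` and `D` follow by comparing the two sums of the
recursion, once the commutators of `d` and `D` with single modes are known. The grading is direct
because the weight spaces sit in distinct eigenspaces of a scaling operator.

For weak associativity the second ingredient is `mode_vertexOp`, for n ≥ 0: a(n+1/2) Y(u,x) =
Y(Pu,x) a(n+1/2) + ∑_i C(n,i) x^{n-i} Y(a(i+1/2)u, x). Let u₁ = a(-m-1/2)u. Inserting both formulas
in Y(u₁,x₁)Y(u₂,x₂)v gives three families of terms, with factors x₁^s, x₁^{-n-m-1} and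
(x₁-x₂)^{-i-m-1} (`productTwo_stabilizes`). Using the recursion twice in Y(Y(u₁,x₀)u₂,x₂)v gives the
same families with factors (x₀+x₂)^s, (x₂+x₀)^{-n-m-1} and x₀^{-i-m-1} (`iterateSeries_stabilizes`).
Under x₁ = x₀+x₂ they match through the induction hypothesis, except that the negative powers in the
second family are expanded in opposite directions. A power of x₀+x₂ removes this discrepancy. Only n
with a(n+1/2)v ≠ 0 occur there, so the power needed depends on u₁ and v but not on u₂
(`assocWith_mode`). -/

variable {B ℓ} in
lemma fock_induction {p : Fock B ℓ → Prop} (vac : p (vac B ℓ))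
    (mode : ∀ (a : 𝔥) (m : ℕ) (v : Fock B ℓ), p v → p (mode B ℓ a (-(m : ℤ) - 1) v))
    (add : ∀ v w, p v → p w → p (v + w)) (smul : ∀ (c : ℂ) v, p v → p (c • v)) (v : Fock B ℓ) :
    p v := by
  obtain ⟨K, hK⟩ := exists_bounded v
  induction hK with
  | vac => exact vac
  | zero => simpa using smul 0 _ vac
  | neg b j _ v _ ih => exact mode b j v ih
  | add v w _ _ ihv ihw => exact add v w ihv ihw
  | smul c v _ ih => exact smul c v ih

variable {B ℓ} in
lemma fock_ext {E : Type*} [AddCommGroup E] [Module ℂ E] {f g : Fock B ℓ →ₗ[ℂ] E}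
    (vac : f (vac B ℓ) = g (FermionicMOSVA.vac B ℓ))
    (mode : ∀ (a : 𝔥) (m : ℕ) (v : Fock B ℓ), f v = g v →
      f (mode B ℓ a (-(m : ℤ) - 1) v) = g (FermionicMOSVA.mode B ℓ a (-(m : ℤ) - 1) v))
    (v : Fock B ℓ) : f v = g v := by
  induction v using fock_induction with
  | vac => exact vac
  | mode a m v ih => exact mode a m v ih
  | add v w hv hw => rw [map_add, map_add, hv, hw]
  | smul c v hv => rw [map_smul, map_smul, hv]

lemma mode_vac (a : 𝔥) (n : ℤ) (hn : 0 ≤ n) : mode B ℓ a n (vac B ℓ) = 0 := gen_vac B ℓ a n hn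

lemma mode_ofTensor (a : 𝔥) (m : ℕ) (x : TensorAlgebra ℂ (Neg 𝔥)) :
    mode B ℓ a (-(m : ℤ) - 1) (ofTensor B ℓ x)
      = ofTensor B ℓ (TensorAlgebra.ι ℂ (DirectSum.lof ℂ ℕ (fun _ => 𝔥) m a) * x) := by
  rw [ofTensor_ι_mul, negGen_lof, mode_apply]

/-- The operator which multiplies `h₁(-m₁ - 1/2) ⋯ h_r(-m_r - 1/2) 𝟏` by `q` to the power
`2 (m₁ + ⋯ + m_r) + r`. -/
def scaleOp (q : ℂ) : Module.End ℂ (Fock B ℓ) :=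
  ofTensor B ℓ ∘ₗ (TensorAlgebra.lift ℂ (TensorAlgebra.ι ℂ ∘ₗ DirectSum.toModule ℂ ℕ (Neg 𝔥)
    fun m => q ^ (2 * m + 1) • DirectSum.lof ℂ ℕ (fun _ => 𝔥) m)).toLinearMap ∘ₗ
    (tensorEquiv B ℓ).symm.toLinearMap

lemma tensorEquiv_symm_ofTensor (x : TensorAlgebra ℂ (Neg 𝔥)) :
    (tensorEquiv B ℓ).symm (ofTensor B ℓ x) = x :=
  (tensorEquiv B ℓ).symm_apply_apply x

lemma scaleOp_vac (q : ℂ) : scaleOp B ℓ q (vac B ℓ) = vac B ℓ := by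
  rw [← ofTensor_one]
  simp [scaleOp, tensorEquiv_symm_ofTensor]

lemma scaleOp_mode (q : ℂ) (a : 𝔥) (m : ℕ) (v : Fock B ℓ) :
    scaleOp B ℓ q (mode B ℓ a (-(m : ℤ) - 1) v)
      = q ^ (2 * m + 1) • mode B ℓ a (-(m : ℤ) - 1) (scaleOp B ℓ q v) := by
  obtain ⟨x, rfl⟩ := ofTensor_surjective B ℓ v
  rw [mode_ofTensor]
  simp only [scaleOp, LinearMap.comp_apply, LinearEquiv.coe_coe, tensorEquiv_symm_ofTensor,
    AlgHom.toLinearMap_apply, map_mul, TensorAlgebra.lift_ι_apply, DirectSum.toModule_lof,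
    LinearMap.smul_apply, mode_ofTensor, map_smul, smul_mul_assoc]

/-- The parity operator, `(-1)^r` on `h₁(-m₁ - 1/2) ⋯ h_r(-m_r - 1/2) 𝟏`. -/
def parity : Module.End ℂ (Fock B ℓ) := scaleOp B ℓ (-1)

lemma parity_vac : parity B ℓ (vac B ℓ) = vac B ℓ := scaleOp_vac B ℓ _

/-- A creation mode adds one factor. An annihilation mode is pushed to the right through creation
modes, and each contraction removes exactly one factor, so it is odd as well. -/
lemma parity_mode (a : 𝔥) (n : ℤ) (v : Fock B ℓ) :
    parity B ℓ (mode B ℓ a n v) = -mode B ℓ a n (parity B ℓ v) := by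
  have neg : ∀ (b : 𝔥) (m : ℕ) (v : Fock B ℓ), parity B ℓ (mode B ℓ b (-(m : ℤ) - 1) v)
      = -mode B ℓ b (-(m : ℤ) - 1) (parity B ℓ v) := fun b m v => by
    rw [parity, scaleOp_mode, Odd.neg_one_pow ⟨m, rfl⟩, neg_one_smul]
  rcases lt_or_ge n 0 with hn | hn
  · obtain ⟨m, rfl⟩ : ∃ m : ℕ, n = -(m : ℤ) - 1 := ⟨(-n - 1).toNat, by omega⟩
    exact neg a m v
  · refine fock_ext (f := parity B ℓ ∘ₗ mode B ℓ a n) (g := -(mode B ℓ a n ∘ₗ parity B ℓ)) ?_ ?_ v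
    · simp [parity_vac, mode_vac B ℓ a n hn]
    · intro b m v hv
      simp only [LinearMap.comp_apply, LinearMap.neg_apply] at hv ⊢
      rw [mode_anticomm B ℓ a b n hn, map_sub, neg, neg, map_neg, mode_anticomm B ℓ a b n hn, hv]
      split_ifs <;> simp

lemma parity_parity (v : Fock B ℓ) : parity B ℓ (parity B ℓ v) = v := by
  refine fock_ext (f := parity B ℓ ∘ₗ parity B ℓ) (g := LinearMap.id) ?_ ?_ v
  · simp [parity_vac]
  · intro b m v hv
    simp only [LinearMap.comp_apply, LinearMap.id_apply] at hv ⊢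
    rw [parity_mode, map_neg, parity_mode, hv, neg_neg]

/-- This is not a relation of `N`; it holds only on `V`. Both products kill the vacuum, and moving
them past a creation mode produces contraction terms that cancel in the anticommutator. -/
lemma mode_anticomm_pos (a b : 𝔥) (m n : ℤ) (hm : 0 ≤ m) (hn : 0 ≤ n) (v : Fock B ℓ) :
    mode B ℓ a m (mode B ℓ b n v) = -mode B ℓ b n (mode B ℓ a m v) := by
  refine fock_ext (f := mode B ℓ a m ∘ₗ mode B ℓ b n) (g := -(mode B ℓ b n ∘ₗ mode B ℓ a m)) ?_ ?_ v
  · simp [mode_vac, hm, hn]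
  · intro c j v hv
    simp only [LinearMap.comp_apply, LinearMap.neg_apply] at hv ⊢
    rw [mode_anticomm B ℓ b c n hn, mode_anticomm B ℓ a c m hm, map_sub, map_sub,
      mode_anticomm B ℓ b c n hn, mode_anticomm B ℓ a c m hm, hv]
    split_ifs <;> (simp; try abel)

lemma exists_mode_eq_zero (v : Fock B ℓ) :
    ∃ K : ℕ, ∀ (a : 𝔥) (n : ℕ), K ≤ n → mode B ℓ a n v = 0 := by
  obtain ⟨K, hK⟩ := exists_bounded v
  exact ⟨K, fun a n hn => (hK.mode_pos a n (by omega)).2 (by omega)⟩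

lemma scaleOp_monomial (q : ℂ) {r : ℕ} (h : Fin r → 𝔥) (m : Fin r → ℕ) :
    scaleOp B ℓ q (monomial B ℓ h m) = q ^ (2 * ∑ i, m i + r) • monomial B ℓ h m := by
  induction r with
  | zero => simp [monomial, scaleOp_vac]
  | succ r ih =>
    have e : monomial B ℓ h m
        = mode B ℓ (h 0) (-(m 0 : ℤ) - 1) (monomial B ℓ (Fin.tail h) (Fin.tail m)) := by
      rw [mode_monomial, Fin.cons_self_tail, Fin.cons_self_tail]
    rw [e, scaleOp_mode, ih, map_smul, smul_smul, ← pow_add, Fin.sum_univ_succ]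
    congr 2
    simp only [Fin.tail]
    ring

/-! ### The grading by weight -/

lemma vac_mem_weightSpace : vac B ℓ ∈ weightSpace B ℓ 0 :=
  Submodule.subset_span ⟨0, Fin.elim0, Fin.elim0, by simp, by simp [monomial]⟩

lemma mode_neg_mem_weightSpace (a : 𝔥) (j : ℕ) {k : ℤ} {v : Fock B ℓ} (hv : v ∈ weightSpace B ℓ k) :
    mode B ℓ a (-(j : ℤ) - 1) v ∈ weightSpace B ℓ (k + 2 * j + 1) := by
  refine (Submodule.span_le (p := (weightSpace B ℓ (k + 2 * j + 1)).comap
    (mode B ℓ a (-(j : ℤ) - 1)))).2 ?_ hv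
  rintro _ ⟨r, h, m, hk, rfl⟩
  refine Submodule.subset_span ⟨r + 1, _, _, ?_, mode_monomial B ℓ a j h m⟩
  rw [Fin.sum_univ_succ]
  simp only [Fin.cons_zero, Fin.cons_succ]
  push_cast
  linarith

/-- The contraction with the first factor is nonzero only when its index equals n, so that exactly
the doubled weight 2n+1 is removed; the other term is handled by induction on r. -/
lemma mode_monomial_mem_weightSpace (a : 𝔥) (n : ℤ) (hn : 0 ≤ n) {r : ℕ} (h : Fin r → 𝔥)
    (m : Fin r → ℕ) : mode B ℓ a n (monomial B ℓ h m)
      ∈ weightSpace B ℓ (2 * ∑ i, (m i : ℤ) + r - 2 * n - 1) := by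
  induction r with
  | zero => simp [monomial, mode_vac B ℓ a n hn]
  | succ r ih =>
    have e : monomial B ℓ h m
        = mode B ℓ (h 0) (-(m 0 : ℤ) - 1) (monomial B ℓ (Fin.tail h) (Fin.tail m)) := by
      rw [mode_monomial, Fin.cons_self_tail, Fin.cons_self_tail]
    rw [e, mode_anticomm B ℓ a (h 0) n hn]
    refine Submodule.sub_mem _ ?_ ?_
    · split_ifs with hnm
      · refine Submodule.smul_mem _ _ (Submodule.subset_span ⟨r, _, _, ?_, rfl⟩)
        rw [Fin.sum_univ_succ, hnm]
        simp only [Fin.tail]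
        push_cast
        ring
      · exact Submodule.zero_mem _
    · have := mode_neg_mem_weightSpace B ℓ (h 0) (m 0) (ih (Fin.tail h) (Fin.tail m))
      convert this using 2
      rw [Fin.sum_univ_succ]
      simp only [Fin.tail]
      push_cast
      ring

lemma mode_mem_weightSpace (a : 𝔥) (n : ℤ) {k : ℤ} {v : Fock B ℓ} (hv : v ∈ weightSpace B ℓ k) :
    mode B ℓ a n v ∈ weightSpace B ℓ (k - 2 * n - 1) := by
  rcases lt_or_ge n 0 with hn | hn
  · obtain ⟨j, rfl⟩ : ∃ m : ℕ, n = -(m : ℤ) - 1 := ⟨(-n - 1).toNat, by omega⟩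
    convert mode_neg_mem_weightSpace B ℓ a j hv using 2
    ring
  · refine (Submodule.span_le (p := (weightSpace B ℓ (k - 2 * n - 1)).comap
      (mode B ℓ a n))).2 ?_ hv
    rintro _ ⟨r, h, m, rfl, rfl⟩
    exact mode_monomial_mem_weightSpace B ℓ a n hn h m

lemma weightSpace_le_eigenspace (k : ℤ) :
    weightSpace B ℓ k ≤ (scaleOp B ℓ 2).eigenspace ((2 : ℂ) ^ k) := by
  refine Submodule.span_le.2 ?_
  rintro _ ⟨r, h, m, rfl, rfl⟩
  rw [SetLike.mem_coe, Module.End.mem_eigenspace_iff, scaleOp_monomial]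
  congr 1
  rw [← zpow_natCast]
  congr 1
  push_cast
  ring

lemma iSup_weightSpace : ⨆ k, weightSpace B ℓ k = ⊤ := by
  rw [eq_top_iff, ← span_monomial B ℓ]
  refine Submodule.span_le.2 ?_
  rintro _ ⟨r, h, m, rfl⟩
  exact (le_iSup (weightSpace B ℓ) _) (Submodule.subset_span ⟨r, h, m, rfl, rfl⟩)

/-- Independence comes from the eigenspaces of `scaleOp B ℓ 2`: the k-th weight space has eigenvalue
2^k, and these are pairwise distinct. -/
theorem isInternal_weightSpace : DirectSum.IsInternal (weightSpace B ℓ) := by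
  refine DirectSum.isInternal_submodule_of_iSupIndep_of_iSup_eq_top ?_ (iSup_weightSpace B ℓ)
  -- Taking norms reduces the claim to powers of the real number 2.
  have hinj : Function.Injective fun k : ℤ => (2 : ℂ) ^ k := fun i j hij =>
    zpow_right_injective₀ (a := (2 : ℝ)) (by norm_num) (by norm_num)
      (by simpa using congrArg norm hij)
  exact ((Module.End.eigenspaces_iSupIndep (scaleOp B ℓ 2)).comp hinj).mono
    fun k => weightSpace_le_eigenspace B ℓ k

lemma weightSpace_eq_bot {k : ℤ} (hk : k < 0) : weightSpace B ℓ k = ⊥ := by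
  refine Submodule.span_eq_bot.2 ?_
  rintro _ ⟨r, h, m, h', rfl⟩
  have : 0 ≤ ∑ i, (m i : ℤ) := Finset.sum_nonneg fun i _ => by positivity
  omega

lemma weightOp_of_mem (hA : DirectSum.IsInternal (weightSpace B ℓ)) {k : ℤ} {v : Fock B ℓ}
    (hv : v ∈ weightSpace B ℓ k) : weightOp (weightSpace B ℓ) hA v = ((k : ℂ) / 2) • v := by
  have : (LinearEquiv.ofBijective (DirectSum.coeLinearMap (weightSpace B ℓ)) hA).symm v
      = DirectSum.lof ℂ ℤ (fun k => weightSpace B ℓ k) k ⟨v, hv⟩ := by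
    rw [LinearEquiv.symm_apply_eq]
    exact (DirectSum.coeLinearMap_lof (weightSpace B ℓ) k ⟨v, hv⟩).symm
  rw [weightOp, LinearMap.comp_apply, LinearEquiv.coe_coe, this, DirectSum.toModule_lof]
  rfl

lemma weightOp_mode (hA : DirectSum.IsInternal (weightSpace B ℓ)) (a : 𝔥) (n : ℤ) (v : Fock B ℓ) :
    weightOp (weightSpace B ℓ) hA (mode B ℓ a n v)
      = mode B ℓ a n (weightOp (weightSpace B ℓ) hA v) - ((n : ℂ) + 1 / 2) • mode B ℓ a n v := by
  have hv : v ∈ ⨆ k, weightSpace B ℓ k := by rw [iSup_weightSpace]; trivial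
  induction hv using Submodule.iSup_induction' with
  | mem k v hv =>
    rw [weightOp_of_mem B ℓ hA hv, weightOp_of_mem B ℓ hA (mode_mem_weightSpace B ℓ a n hv), map_smul,
      ← sub_smul]
    congr 1
    push_cast
    ring
  | zero => simp
  | add v w _ _ hv hw => simp only [map_add, hv, hw, smul_add]; abel

end Fock

/-! ### Normally ordered products -/

lemma list_prod_anticomm {R : Type*} [Ring R] (x : R) (L : List R) (hL : ∀ y ∈ L, x * y = -(y * x)) :
    x * L.prod = (-1) ^ L.length * (L.prod * x) := by
  induction L with
  | nil => simp
  | cons y L ih =>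
    rw [List.prod_cons, ← mul_assoc, hL y List.mem_cons_self, neg_mul, mul_assoc,
      ih fun z hz => hL z (List.mem_cons_of_mem _ hz), List.length_cons, pow_succ', neg_one_mul,
      neg_mul, ← mul_assoc, ← ((Commute.neg_one_left y).pow_left L.length).eq]
    simp only [mul_assoc]

/-- Moving the p-th factor to the right end crosses only the r - p factors behind it, so
anticommutation is required with those alone. -/
lemma ofFn_prod_anticomm {R : Type*} [Ring R] {r : ℕ} (g : Fin (r + 1) → R) (p : Fin (r + 1))
    (hg : ∀ j : Fin r, (p : ℕ) ≤ j → g p * g (p.succAbove j) = -(g (p.succAbove j) * g p)) :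
    (List.ofFn g).prod
      = (-1) ^ (r - p : ℕ) * ((List.ofFn fun j => g (p.succAbove j)).prod * g p) := by
  induction r with
  | zero =>
    obtain rfl : p = 0 := Fin.ext (by omega)
    simp
  | succ r ih =>
    refine Fin.cases ?_ (fun p => ?_) p hg
    · intro hg
      rw [List.ofFn_succ, List.prod_cons, list_prod_anticomm]
      · simp [List.length_ofFn]
      · intro y hy
        rw [List.mem_ofFn] at hy
        obtain ⟨j, rfl⟩ := hy
        simpa using hg j (by simp)
    · intro hg
      rw [List.ofFn_succ, List.prod_cons, ih (fun j => g j.succ) p, List.ofFn_succ,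
        List.prod_cons]
      · simp only [Fin.succ_succAbove_zero, Fin.succ_succAbove_succ, Fin.val_succ,
          Nat.add_sub_add_right]
        rw [← mul_assoc, ← ((Commute.neg_one_left (g 0)).pow_left _).eq]
        simp only [mul_assoc]
      · intro j hj
        simpa using hg j.succ (by simpa using hj)

/-- Here p is the place where the new index 0 lands. The remaining indices keep the order given by
`shuffle n`, so the new permutation is the old one on successors, preceded by the cycle that brings
p to 0. -/
lemma shuffle_cons {r : ℕ} (n₀ : ℤ) (n : Fin r → ℤ) (p : Fin (r + 1))
    (hp : ∀ j : Fin r, j.castSucc < p → 0 ≤ n₀ ∧ n (shuffle n j) < 0)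
    (hp' : ∀ j : Fin r, p ≤ j.castSucc → 0 ≤ n₀ → 0 ≤ n (shuffle n j)) :
    shuffle (Fin.cons n₀ n : Fin (r + 1) → ℤ)
      = Equiv.Perm.decomposeFin.symm (0, shuffle n) * p.cycleRange := by
  have e0 : (Equiv.Perm.decomposeFin.symm (0, shuffle n) * p.cycleRange) p = 0 := by
    simp [Fin.cycleRange_self]
  have e1 : ∀ j, (Equiv.Perm.decomposeFin.symm (0, shuffle n) * p.cycleRange) (p.succAbove j)
      = (shuffle n j).succ := fun j => by
    simp [Fin.cycleRange_succAbove, Equiv.Perm.decomposeFin_symm_apply_succ]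
  -- The sort is stable, so it is characterized by monotone values together with increasing indices
  -- on ties. Both pass from `shuffle n` to the old indices; only comparisons with the new index
  -- need the hypotheses on p.
  have hs := (Tuple.eq_sort_iff (σ := shuffle n)
    (f := fun i => if n i < 0 then (0 : ℕ) else 1)).1 rfl
  have key : ∀ i j : Fin (r + 1), i < j → ∀ σ : Equiv.Perm (Fin (r + 1)),
      σ = Equiv.Perm.decomposeFin.symm (0, shuffle n) * p.cycleRange →
      let f : Fin (r + 1) → ℕ := fun i => if (Fin.cons n₀ n : Fin (r + 1) → ℤ) i < 0 then 0 else 1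
      f (σ i) ≤ f (σ j) ∧ (f (σ i) = f (σ j) → σ i < σ j) := by
    rintro i j hij σ rfl f
    rcases Fin.eq_self_or_eq_succAbove p i with hi | ⟨i, rfl⟩ <;>
      rcases Fin.eq_self_or_eq_succAbove p j with hj | ⟨j, rfl⟩
    · exact absurd hij (by rw [hi, hj]; exact lt_irrefl _)
    · subst hi
      rw [e0, e1]
      have h2 : i ≤ j.castSucc := by
        rwa [Fin.lt_succAbove_iff_le_castSucc] at hij
      refine ⟨?_, fun _ => Fin.succ_pos _⟩
      simp only [f, Fin.cons_zero, Fin.cons_succ]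
      have := hp' j h2
      split_ifs <;> omega
    · rw [hj] at hij ⊢
      rw [e0, e1]
      have h2 : i.castSucc < p := by
        rwa [Fin.succAbove_lt_iff_castSucc_lt] at hij
      have := hp i h2
      simp only [f, Fin.cons_zero, Fin.cons_succ, if_pos this.2, if_neg (not_lt.2 this.1)]
      simp
    · rw [e1, e1]
      have h2 : i < j := (Fin.strictMono_succAbove p).lt_iff_lt.1 hij
      refine ⟨by simpa [f] using hs.1 h2.le, fun h => Fin.succ_lt_succ_iff.2 (hs.2 i j h2 ?_)⟩
      simpa [f] using h
  refine ((Tuple.eq_sort_iff).2 ⟨fun i j hij => ?_, fun i j hij => ?_⟩).symm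
  · rcases hij.eq_or_lt with rfl | hij
    · exact le_rfl
    · exact (key i j hij _ rfl).1
  · exact (key i j hij _ rfl).2

section Fock

variable {𝔥 : Type*} [AddCommGroup 𝔥] [Module ℂ 𝔥] (B : LinearMap.BilinForm ℂ 𝔥) (ℓ : ℂ)

/-- The sign (-1)^p is that of the cycle in `shuffle_cons`; the list of factors is the old ordered
product with the mode of `a` inserted at position p. -/
lemma nord_cons_aux {r : ℕ} (a : 𝔥) (h : Fin r → 𝔥) (n₀ : ℤ) (n : Fin r → ℤ) (p : Fin (r + 1))
    (hp : ∀ j : Fin r, j.castSucc < p → 0 ≤ n₀ ∧ n (shuffle n j) < 0)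
    (hp' : ∀ j : Fin r, p ≤ j.castSucc → 0 ≤ n₀ → 0 ≤ n (shuffle n j)) :
    ∃ g : Fin (r + 1) → Module.End ℂ (Fock B ℓ),
      nord B ℓ (Fin.cons a h : Fin (r + 1) → 𝔥) (Fin.cons n₀ n : Fin (r + 1) → ℤ)
        = ((-1) ^ (p : ℕ) * Equiv.Perm.sign (shuffle n) : ℤ) • (List.ofFn g).prod
      ∧ g p = mode B ℓ a n₀
      ∧ ∀ j, g (p.succAbove j) = mode B ℓ (h (shuffle n j)) (n (shuffle n j)) := by
  refine ⟨fun i => mode B ℓ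
      ((Fin.cons a h : Fin (r + 1) → 𝔥) (shuffle (Fin.cons n₀ n : Fin (r + 1) → ℤ) i))
      ((Fin.cons n₀ n : Fin (r + 1) → ℤ) (shuffle (Fin.cons n₀ n : Fin (r + 1) → ℤ) i)),
    ?_, ?_, ?_⟩
  rotate_left
  · simp [shuffle_cons n₀ n p hp hp', Fin.cycleRange_self]
  · intro j
    simp [shuffle_cons n₀ n p hp hp', Fin.cycleRange_succAbove,
      Equiv.Perm.decomposeFin_symm_apply_succ]
  · rw [nord]
    congr 1
    rw [shuffle_cons n₀ n p hp hp', Equiv.Perm.sign_mul, Equiv.Perm.decomposeFin.symm_sign,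
      Fin.sign_cycleRange]
    simp [mul_comm]

lemma nord_cons_neg {r : ℕ} (a : 𝔥) (h : Fin r → 𝔥) (n₀ : ℤ) (n : Fin r → ℤ) (hn : n₀ < 0)
    (w : Fock B ℓ) :
    nord B ℓ (Fin.cons a h : Fin (r + 1) → 𝔥) (Fin.cons n₀ n : Fin (r + 1) → ℤ) w
      = mode B ℓ a n₀ (nord B ℓ h n w) := by
  obtain ⟨g, hg, hg0, hgs⟩ := nord_cons_aux B ℓ a h n₀ n 0
    (fun j hj => absurd hj (Fin.not_lt_zero _)) (fun j _ h0 => by omega)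
  have hgs' : (fun i : Fin r => g i.succ)
      = fun j => mode B ℓ (h (shuffle n j)) (n (shuffle n j)) := funext fun j => by
    simpa using hgs j
  rw [hg, List.ofFn_succ, List.prod_cons, hg0, hgs', nord]
  simp

/-- The ordering moves the new mode past the p negative modes with sign (-1)^p. Carrying it further
through the r - p nonnegative modes uses `mode_anticomm_pos` and completes the sign to (-1)^r. -/
lemma nord_cons_pos {r : ℕ} (a : 𝔥) (h : Fin r → 𝔥) (n₀ : ℤ) (n : Fin r → ℤ) (hn : 0 ≤ n₀)
    (w : Fock B ℓ) :
    nord B ℓ (Fin.cons a h : Fin (r + 1) → 𝔥) (Fin.cons n₀ n : Fin (r + 1) → ℤ) w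
      = ((-1) ^ r : ℤ) • nord B ℓ h n (mode B ℓ a n₀ w) := by
  set f : Fin r → ℕ := (fun i => if n i < 0 then (0 : ℕ) else 1) ∘ shuffle n with hf
  have hmono : Monotone f := Tuple.monotone_sort _
  have hcard : (Finset.univ.filter fun i => f i ≤ 0).card < r + 1 := by
    have := (Finset.univ.filter fun i => f i ≤ 0).card_le_univ
    rw [Fintype.card_fin] at this
    omega
  have hlt : ∀ j : Fin r, (j : ℕ) < (Finset.univ.filter fun i => f i ≤ 0).card
      ↔ n (shuffle n j) < 0 := fun j => by
    rw [Tuple.lt_card_le_iff_apply_le_of_monotone hmono, hf]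
    simp only [Function.comp_apply]
    split_ifs with h <;> simp [h]
  -- The new mode lands right behind all negative ones and, having the smallest index, in front of
  -- the other nonnegative ones; so p counts the negative modes.
  set p : Fin (r + 1) := ⟨(Finset.univ.filter fun i => f i ≤ 0).card, hcard⟩ with hp
  obtain ⟨g, hg, hg0, hgs⟩ := nord_cons_aux B ℓ a h n₀ n p
    (fun j hj => ⟨hn, (hlt j).1 hj⟩) (fun j hj _ => not_lt.1 fun h => by
      have := (hlt j).2 h
      rw [Fin.le_def] at hj
      simp only [hp, Fin.val_castSucc] at hj
      omega)
  rw [hg, ofFn_prod_anticomm g p, hg0, nord]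
  · have e : (List.ofFn fun j => g (p.succAbove j))
        = List.ofFn fun i => mode B ℓ (h (shuffle n i)) (n (shuffle n i)) := by
      congr 1; exact funext hgs
    have hpow : ((-1 : Module.End ℂ (Fock B ℓ)) ^ (r - p : ℕ))
        = (((-1) ^ (r - p : ℕ) : ℤ) : Module.End ℂ (Fock B ℓ)) := by
      push_cast; rfl
    rw [e, hpow, ← zsmul_eq_mul, smul_smul, LinearMap.smul_apply, LinearMap.smul_apply, smul_smul,
      Module.End.mul_apply]
    congr 1
    rw [mul_right_comm, ← pow_add, Nat.add_sub_cancel' (Nat.lt_succ_iff.1 p.2)]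
  · intro j hj
    rw [hg0, hgs]
    refine LinearMap.ext fun v => mode_anticomm_pos B ℓ _ _ _ _ hn (not_lt.1 fun h => ?_) v
    have := (hlt j).2 h
    simp only [hp] at hj
    omega

end Fock

/-! ### The recursion for vertex operators -/

/-- Writing the sum with any sufficiently large cutoff N lets several such expansions be compared
later at one common N, without tracking supports. -/
lemma eventually_finsum_int {E : Type*} [AddCommGroup E] (m : ℕ) (g : ℤ → E)
    (hg : (Function.support g).Finite) (hm : ∀ j : ℕ, j < m → g (-(j : ℤ) - 1) = 0) :
    ∀ᶠ N : ℕ in Filter.atTop, ∑ᶠ n, g n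
      = ∑ s ∈ Finset.range N, g (-((m + s : ℕ) : ℤ) - 1) + ∑ n ∈ Finset.range N, g (n : ℤ) := by
  obtain ⟨b, hb⟩ := hg.bddAbove
  obtain ⟨c, hc⟩ := hg.bddBelow
  filter_upwards [Filter.eventually_ge_atTop (b.toNat + (-c).toNat + 1)] with N hN
  have hsub : Function.support g ⊆ ↑((Finset.range N).image (fun s : ℕ => -((m + s : ℕ) : ℤ) - 1)
      ∪ (Finset.range N).image (fun n : ℕ => (n : ℤ))) := by
    intro n hn
    have h1 := hb hn
    have h2 := hc hn
    simp only [Finset.coe_union, Finset.coe_image, Finset.coe_range, Set.mem_union, Set.mem_image,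
      Set.mem_Iio]
    rcases lt_or_ge n 0 with h0 | h0
    · left
      have h3 : m ≤ (-n - 1).toNat := by
        by_contra hlt
        refine hn ?_
        have := hm _ (not_le.1 hlt)
        rwa [show -((-n - 1).toNat : ℤ) - 1 = n by omega] at this
      exact ⟨(-n - 1).toNat - m, by omega, by omega⟩
    · right
      exact ⟨n.toNat, by omega, by omega⟩
  rw [finsum_eq_sum_of_support_subset g hsub, Finset.sum_union, Finset.sum_image, Finset.sum_image]
  · intro i _ j _ h
    simpa using h
  · intro i _ j _ h
    simp only at h
    omega
  · rw [Finset.disjoint_left]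
    intro x hx hx'
    simp only [Finset.mem_image, Finset.mem_range] at hx hx'
    omega

section Fock

variable {𝔥 : Type*} [AddCommGroup 𝔥] [Module ℂ 𝔥] (B : LinearMap.BilinForm ℂ 𝔥) (ℓ : ℂ)

/-- A summand of `nordSeries`. -/
def nordTerm {r : ℕ} (h : Fin r → 𝔥) (m : Fin r → ℕ) (w : Fock B ℓ) (k : ℤ) (n : Fin r → ℤ) :
    Fock B ℓ :=
  if ∑ i, (-n i - m i - 1) = k then (∏ i, Ring.choose (-n i - 1) (m i)) • nord B ℓ h n w else 0

lemma nordSeries_eq {r : ℕ} (h : Fin r → 𝔥) (m : Fin r → ℕ) (w : Fock B ℓ) (k : ℤ) :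
    nordSeries B ℓ h m w k = ∑ᶠ n, nordTerm B ℓ h m w k n :=
  finsum_congr fun _ => finsum_eq_if

lemma nordTerm_finite {r : ℕ} (h : Fin r → 𝔥) (m : Fin r → ℕ) (w : Fock B ℓ) (k : ℤ) :
    (Function.support (nordTerm B ℓ h m w k)).Finite := by
  refine (nordSeries_finite B ℓ h m w k).subset fun n hn => ?_
  rw [Function.mem_support, nordTerm] at hn
  split_ifs at hn with hk
  · exact ⟨hk, fun h0 => hn (by rw [h0, smul_zero])⟩
  · exact absurd rfl hn

/-- The summand of `nordSeries_cons`. -/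
def consTerm {r : ℕ} (a : 𝔥) (h : Fin r → 𝔥) (m₀ : ℕ) (m : Fin r → ℕ) (w : Fock B ℓ) (k n : ℤ) :
    Fock B ℓ :=
  Ring.choose (-n - 1) m₀ • if n < 0 then mode B ℓ a n (nordSeries B ℓ h m w (k + n + m₀ + 1))
    else ((-1) ^ r : ℤ) • nordSeries B ℓ h m (mode B ℓ a n w) (k + n + m₀ + 1)

/-- With the first mode fixed, its operator comes out of the sum over the others: on the left if it
is negative, acting on w if it is nonnegative. -/
lemma finsum_nordTerm_cons {r : ℕ} (a : 𝔥) (h : Fin r → 𝔥) (m₀ : ℕ) (m : Fin r → ℕ) (w : Fock B ℓ)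
    (k n₀ : ℤ) :
    ∑ᶠ n : Fin r → ℤ, nordTerm B ℓ (Fin.cons a h : Fin (r + 1) → 𝔥)
      (Fin.cons m₀ m : Fin (r + 1) → ℕ) w k (Fin.cons n₀ n : Fin (r + 1) → ℤ)
      = consTerm B ℓ a h m₀ m w k n₀ := by
  have hk : ∀ n : Fin r → ℤ, (-n₀ - m₀ - 1 + ∑ i, (-n i - m i - 1) = k)
      ↔ (∑ i, (-n i - m i - 1) = k + n₀ + m₀ + 1) := fun n => by
    constructor <;> intro h <;> linarith
  rw [consTerm]
  split_ifs with hn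
  · rw [nordSeries_eq, map_finsum (mode B ℓ a n₀) (nordTerm_finite B ℓ h m w _),
      smul_finsum' _ ((nordTerm_finite B ℓ h m w _).subset fun n hn => fun h0 =>
        hn (by rw [h0, map_zero]))]
    refine finsum_congr fun n => ?_
    rw [nordTerm, nordTerm, nord_cons_neg B ℓ a h n₀ n hn]
    simp only [Fin.sum_univ_succ, Fin.prod_univ_succ, Fin.cons_zero, Fin.cons_succ, hk]
    split_ifs
    · rw [map_zsmul, mul_smul]
    · simp
  · have hfin := nordTerm_finite B ℓ h m (mode B ℓ a n₀ w) (k + n₀ + m₀ + 1)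
    rw [nordSeries_eq, smul_finsum' _ hfin,
      smul_finsum' _ (hfin.subset fun n hn => fun h0 => hn (by rw [h0, smul_zero]))]
    refine finsum_congr fun n => ?_
    rw [nordTerm, nordTerm, nord_cons_pos B ℓ a h n₀ n (not_lt.1 hn)]
    simp only [Fin.sum_univ_succ, Fin.prod_univ_succ, Fin.cons_zero, Fin.cons_succ, hk]
    split_ifs
    · rw [mul_smul, smul_comm ((-1) ^ r : ℤ)]
    · simp

/-- The finite sum over all mode tuples is iterated with the first mode outermost. Finiteness of the
outer support is kept because the cutoff form of the sum needs it. -/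
lemma nordSeries_cons {r : ℕ} (a : 𝔥) (h : Fin r → 𝔥) (m₀ : ℕ) (m : Fin r → ℕ) (w : Fock B ℓ)
    (k : ℤ) :
    (Function.support (consTerm B ℓ a h m₀ m w k)).Finite ∧
    nordSeries B ℓ (Fin.cons a h : Fin (r + 1) → 𝔥) (Fin.cons m₀ m : Fin (r + 1) → ℕ) w k
      = ∑ᶠ n, consTerm B ℓ a h m₀ m w k n := by
  set F := nordTerm B ℓ (Fin.cons a h : Fin (r + 1) → 𝔥) (Fin.cons m₀ m : Fin (r + 1) → ℕ) w k
    with hF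
  have hfin : (Function.support F).Finite := nordTerm_finite B ℓ _ _ w k
  set e := Fin.consEquiv (fun _ : Fin (r + 1) => ℤ) with he
  have hfin' : (Function.support fun x => F (e x)).Finite := by
    have : (Function.support fun x => F (e x)) = e ⁻¹' Function.support F := rfl
    rw [this]
    exact hfin.preimage e.injective.injOn
  have hc : ∀ n₀, ∑ᶠ n, F (e (n₀, n)) = consTerm B ℓ a h m₀ m w k n₀ := fun n₀ =>
    finsum_nordTerm_cons B ℓ a h m₀ m w k n₀
  constructor
  · refine (hfin'.image Prod.fst).subset fun n hn => ?_
    rw [Function.mem_support, ← hc] at hn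
    by_contra! hx
    exact hn (finsum_eq_zero_of_forall_eq_zero fun x => by
      by_contra hne
      exact hx ⟨(n, x), hne, rfl⟩)
  · rw [nordSeries_eq, ← finsum_comp_equiv e, finsum_curry _ hfin']
    exact finsum_congr hc

lemma parity_monomial {r : ℕ} (h : Fin r → 𝔥) (m : Fin r → ℕ) :
    parity B ℓ (monomial B ℓ h m) = ((-1) ^ r : ℤ) • monomial B ℓ h m := by
  rw [parity, scaleOp_monomial, pow_add, pow_mul]
  rw [← Int.cast_smul_eq_zsmul ℂ]
  simp

/-- The vertex operator of `a(-m - 1/2) u` in terms of that of `u`. -/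
theorem vertexOp_mode (a : 𝔥) (m : ℕ) (u w : Fock B ℓ) (k : ℤ) : ∀ᶠ N : ℕ in Filter.atTop,
    vertexOp B ℓ (mode B ℓ a (-(m : ℤ) - 1) u) w k
      = ∑ s ∈ Finset.range N, (m + s).choose m •
          mode B ℓ a (-((m + s : ℕ) : ℤ) - 1) (vertexOp B ℓ u w (k - s))
        + ∑ n ∈ Finset.range N, Ring.choose (-(n : ℤ) - 1) m •
          vertexOp B ℓ (parity B ℓ u) (mode B ℓ a n w) (k + n + m + 1) := by
  have hu : u ∈ Submodule.span ℂ {v | ∃ (r : ℕ) (h : Fin r → 𝔥) (m : Fin r → ℕ),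
      v = monomial B ℓ h m} := by rw [span_monomial]; trivial
  induction hu using Submodule.span_induction with
  | mem u hu =>
    obtain ⟨r, h, m', rfl⟩ := hu
    obtain ⟨hfin, heq⟩ := nordSeries_cons B ℓ a h m m' w k
    -- At the mode -j-1 the coefficient is C(j,m), which vanishes for j < m; hence the creation part
    -- starts at a(-m-1/2).
    filter_upwards [eventually_finsum_int m _ hfin fun j hj => by
      rw [consTerm, show -(-(j : ℤ) - 1) - 1 = (j : ℤ) by ring, Ring.choose_natCast,
        Nat.choose_eq_zero_of_lt hj]
      simp] with N hN
    rw [mode_monomial, vertexOp_monomial, heq, hN]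
    congr 1
    · refine Finset.sum_congr rfl fun s _ => ?_
      rw [consTerm, if_pos (by omega), vertexOp_monomial,
        show -(-((m + s : ℕ) : ℤ) - 1) - 1 = ((m + s : ℕ) : ℤ) by ring, Ring.choose_natCast,
        show k + (-((m + s : ℕ) : ℤ) - 1) + m + 1 = k - s by push_cast; ring]
      exact natCast_zsmul _ _
    · refine Finset.sum_congr rfl fun n _ => ?_
      rw [consTerm, if_neg (by omega), parity_monomial, map_zsmul, LinearMap.smul_apply,
        Pi.smul_apply, vertexOp_monomial]
  | zero => exact Filter.Eventually.of_forall fun N => by simp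
  | add u v _ _ hu hv =>
    filter_upwards [hu, hv] with N h1 h2
    simp only [map_add, LinearMap.add_apply, Pi.add_apply, smul_add, Finset.sum_add_distrib, h1, h2]
    abel
  | smul c u _ hu =>
    filter_upwards [hu] with N h1
    simp only [map_smul, LinearMap.smul_apply, Pi.smul_apply, h1, smul_add, Finset.smul_sum,
      smul_comm c]

lemma vertexOp_vac (w : Fock B ℓ) (k : ℤ) :
    vertexOp B ℓ (vac B ℓ) w k = if k = 0 then w else 0 := by
  have : vac B ℓ = monomial B ℓ (Fin.elim0 : Fin 0 → 𝔥) Fin.elim0 := by simp [monomial]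
  rw [this, vertexOp_monomial, nordSeries_eq, finsum_eq_single _ Fin.elim0 fun n hn =>
    absurd (Subsingleton.elim _ _) hn]
  have hs : shuffle (Fin.elim0 : Fin 0 → ℤ) = 1 := Subsingleton.elim _ _
  simp [nordTerm, nord, hs, eq_comm]

/-- `Y(u, x) v` has finitely many negative powers of `x`. -/
theorem vertexOp_truncation (u v : Fock B ℓ) : ∃ N : ℤ, ∀ n < N, vertexOp B ℓ u v n = 0 := by
  have hu : u ∈ Submodule.span ℂ {v | ∃ (r : ℕ) (h : Fin r → 𝔥) (m : Fin r → ℕ),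
      v = monomial B ℓ h m} := by rw [span_monomial]; trivial
  induction hu using Submodule.span_induction with
  | mem u hu =>
    obtain ⟨r, h, m, rfl⟩ := hu
    obtain ⟨K, hK⟩ := exists_bounded v
    -- If every mode index were below K the exponent would be at least this sum. Below it some index
    -- reaches K, and the normally ordered product then kills v.
    refine ⟨∑ i, (-(K : ℤ) - m i - 1), fun k hk => ?_⟩
    rw [vertexOp_monomial, nordSeries_eq]
    refine finsum_eq_zero_of_forall_eq_zero fun n => ?_
    rw [nordTerm]
    split_ifs with hn
    · obtain ⟨i, hi⟩ : ∃ i, (K : ℤ) ≤ n i := by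
        by_contra! hlt
        have : ∑ i, (-(K : ℤ) - m i - 1) ≤ ∑ i, (-n i - m i - 1) :=
          Finset.sum_le_sum fun i _ => by linarith [hlt i]
        omega
      rw [hK.nord_eq_zero h n i hi, smul_zero]
    · rfl
  | zero => exact ⟨0, fun n _ => by simp⟩
  | add u v _ _ hu hv =>
    obtain ⟨M, hM⟩ := hu
    obtain ⟨N, hN⟩ := hv
    refine ⟨min M N, fun n hn => ?_⟩
    rw [map_add, LinearMap.add_apply, Pi.add_apply, hM n (by omega), hN n (by omega), add_zero]
  | smul c u _ hu =>
    obtain ⟨M, hM⟩ := hu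
    exact ⟨M, fun n hn => by rw [map_smul, LinearMap.smul_apply, Pi.smul_apply, hM n hn, smul_zero]⟩

end Fock

/-! ### Binomial identities and induction with parity -/

lemma sum_range_shift {E : Type*} [AddCommGroup E] (f : ℕ → E) (N : ℕ) (h0 : f 0 = 0)
    (hN : f N = 0) : ∑ s ∈ Finset.range N, f (s + 1) = ∑ s ∈ Finset.range N, f s := by
  have h1 := Finset.sum_range_succ f N
  rw [Finset.sum_range_succ', h0, hN, add_zero, add_zero] at h1
  exact h1

lemma succ_mul_choose_succ (r : ℤ) (m : ℕ) :
    ((m : ℤ) + 1) * Ring.choose r (m + 1) = (r - m) * Ring.choose r m := by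
  have := Ring.choose_add_smul_choose (r - m) 1 m
  rw [Ring.choose_one_right, add_comm 1 m, Nat.choose_succ_self_right, nsmul_eq_mul] at this
  push_cast at this
  rw [sub_add_cancel] at this
  rw [this, mul_comm]

lemma mul_choose_sub_one (r : ℤ) (m : ℕ) :
    r * Ring.choose (r - 1) m = (r - m) * Ring.choose r m := by
  have := Ring.choose_add_smul_choose (r - 1) m 1
  rw [Nat.cast_one, sub_add_cancel, Ring.choose_one_right, add_comm m 1, Nat.choose_one_right,
    nsmul_eq_mul] at this
  rw [← this, ← succ_mul_choose_succ, add_comm 1 m]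
  push_cast
  rfl

section Fock

variable {𝔥 : Type*} [AddCommGroup 𝔥] [Module ℂ 𝔥] (B : LinearMap.BilinForm ℂ 𝔥) (ℓ : ℂ)

-- The annihilation part of the recursion involves `parity B ℓ u`, so the induction hypothesis is
-- needed for it too. Proving the property for v and its parity image simultaneously provides this,
-- since parity is an involution that anticommutes with modes.
variable {B ℓ} in
lemma fock_induction_parity {p : Fock B ℓ → Prop} (vac : p (vac B ℓ))
    (mode : ∀ (a : 𝔥) (m : ℕ) (v : Fock B ℓ), p v → p (parity B ℓ v) →
      p (mode B ℓ a (-(m : ℤ) - 1) v))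
    (add : ∀ v w, p v → p w → p (v + w)) (smul : ∀ (c : ℂ) v, p v → p (c • v)) (v : Fock B ℓ) :
    p v := by
  suffices h : p v ∧ p (parity B ℓ v) from h.1
  induction v using fock_induction with
  | vac => rw [parity_vac]; exact ⟨vac, vac⟩
  | mode a m v ih =>
    refine ⟨mode a m v ih.1 ih.2, ?_⟩
    rw [parity_mode, ← neg_one_smul ℂ]
    exact smul _ _ (mode a m _ ih.2 (by rw [parity_parity]; exact ih.1))
  | add v w hv hw => rw [map_add]; exact ⟨add _ _ hv.1 hw.1, add _ _ hv.2 hw.2⟩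
  | smul c v hv => rw [map_smul]; exact ⟨smul _ _ hv.1, smul _ _ hv.2⟩

lemma eventually_vertexOp_eq_zero (u w : Fock B ℓ) (k : ℤ) :
    ∀ᶠ N : ℕ in Filter.atTop, vertexOp B ℓ u w (k - N) = 0 := by
  obtain ⟨M, hM⟩ := vertexOp_truncation B ℓ u w
  filter_upwards [Filter.eventually_ge_atTop ((k - M).toNat + 1)] with N hN
  exact hM _ (by omega)

lemma eventually_mode_eq_zero (w : Fock B ℓ) :
    ∀ᶠ N : ℕ in Filter.atTop, ∀ a : 𝔥, mode B ℓ a N w = 0 := by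
  obtain ⟨K, hK⟩ := exists_mode_eq_zero B ℓ w
  filter_upwards [Filter.eventually_ge_atTop K] with N hN a using hK a N hN

/-- Each term of the recursion contains exactly one mode of `a`, hence contributes one sign, as does
the creation mode in the first argument. -/
theorem parity_vertexOp (u w : Fock B ℓ) (k : ℤ) :
    parity B ℓ (vertexOp B ℓ u w k) = vertexOp B ℓ (parity B ℓ u) (parity B ℓ w) k := by
  induction u using fock_induction_parity generalizing w k with
  | vac => simp only [parity_vac, vertexOp_vac]; split_ifs <;> simp
  | mode a m u ih ih' =>
    obtain ⟨N, h1, h2⟩ := ((vertexOp_mode B ℓ a m u w k).and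
      (vertexOp_mode B ℓ a m (parity B ℓ u) (parity B ℓ w) k)).exists
    rw [h1, parity_mode, map_neg, LinearMap.neg_apply, Pi.neg_apply, h2, map_add, map_sum, map_sum,
      neg_add, ← Finset.sum_neg_distrib, ← Finset.sum_neg_distrib]
    congr 1
    · refine Finset.sum_congr rfl fun s _ => ?_
      rw [map_nsmul, parity_mode, ih, smul_neg]
    · refine Finset.sum_congr rfl fun n _ => ?_
      rw [map_zsmul, ih', parity_mode, map_neg, Pi.neg_apply, smul_neg]
  | add u v hu hv =>
    simp only [map_add, LinearMap.add_apply, Pi.add_apply, hu, hv]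
  | smul c u hu =>
    simp only [map_smul, LinearMap.smul_apply, Pi.smul_apply, hu]

/-! ### The commutator of a positive mode with a vertex operator -/

/-- For b(-m-1/2)u in place of u, the contraction of `a` with `b` arises once on each side, with the
same coefficient C(n,m). All other terms are matched by the induction hypotheses for u and its
parity image. -/
theorem mode_vertexOp (a : 𝔥) (n : ℕ) (u w : Fock B ℓ) (k : ℤ) :
    mode B ℓ a n (vertexOp B ℓ u w k) = vertexOp B ℓ (parity B ℓ u) (mode B ℓ a n w) k
      + ∑ i ∈ Finset.range (n + 1), n.choose i • vertexOp B ℓ (mode B ℓ a i u) w (k - n + i) := by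
  induction u using fock_induction_parity generalizing w k with
  | vac =>
    rw [parity_vac, vertexOp_vac, vertexOp_vac, Finset.sum_eq_zero fun i _ => by
      rw [mode_vac B ℓ a i (by omega), map_zero]; simp]
    split_ifs <;> simp
  | mode b m u ih ih' =>
    have hall : ∀ᶠ N : ℕ in Filter.atTop, ∀ i ∈ Finset.range (n + 1),
        vertexOp B ℓ (mode B ℓ b (-(m : ℤ) - 1) (mode B ℓ a i u)) w (k - n + i)
      = ∑ s ∈ Finset.range N, (m + s).choose m •
          mode B ℓ b (-((m + s : ℕ) : ℤ) - 1) (vertexOp B ℓ (mode B ℓ a i u) w (k - n + i - s))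
        + ∑ n' ∈ Finset.range N, Ring.choose (-(n' : ℤ) - 1) m •
          vertexOp B ℓ (parity B ℓ (mode B ℓ a i u)) (mode B ℓ b n' w) (k - n + i + n' + m + 1) :=
      (Filter.eventually_all_finset _).2 fun i _ => vertexOp_mode B ℓ b m _ w _
    obtain ⟨N, ⟨h1, h2⟩, h3, hN⟩ := (((vertexOp_mode B ℓ b m u w k).and
      (vertexOp_mode B ℓ b m (parity B ℓ u) (mode B ℓ a n w) k)).and
      (hall.and (Filter.eventually_ge_atTop (n + 1)))).exists
    -- Right side: the mode a(i+1/2) is anticommuted past b(-m-1/2), the contraction occurring at i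
    -- = m, and then the recursion is applied. In the annihilation sum the sign from anticommuting
    -- cancels the sign from parity.
    have hR : ∑ i ∈ Finset.range (n + 1), n.choose i •
          vertexOp B ℓ (mode B ℓ a i (mode B ℓ b (-(m : ℤ) - 1) u)) w (k - n + i)
        = (if m ≤ n then n.choose m • (ℓ * B a b) • vertexOp B ℓ u w (k - n + m) else 0)
          - ∑ s ∈ Finset.range N, (m + s).choose m • mode B ℓ b (-((m + s : ℕ) : ℤ) - 1)
            (∑ i ∈ Finset.range (n + 1), n.choose i •
              vertexOp B ℓ (mode B ℓ a i u) w (k - s - n + i))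
          + ∑ j ∈ Finset.range N, Ring.choose (-(j : ℤ) - 1) m •
            ∑ i ∈ Finset.range (n + 1), n.choose i •
              vertexOp B ℓ (mode B ℓ a i (parity B ℓ u)) (mode B ℓ b j w)
                (k + j + m + 1 - n + i) := by
      have e1 : (if m ≤ n then n.choose m • (ℓ * B a b) • vertexOp B ℓ u w (k - n + m) else 0)
          = ∑ i ∈ Finset.range (n + 1), n.choose i •
            (if (i : ℤ) = m then (ℓ * B a b) • vertexOp B ℓ u w (k - n + i) else 0) := by
        simp only [Nat.cast_inj, smul_ite, smul_zero]
        rw [Finset.sum_ite_eq']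
        simp
      rw [e1]
      simp only [map_sum, Finset.smul_sum]
      rw [Finset.sum_comm, Finset.sum_comm (s := Finset.range N), ← Finset.sum_sub_distrib,
        ← Finset.sum_add_distrib]
      refine Finset.sum_congr rfl fun i hi => ?_
      rw [mode_anticomm B ℓ a b i (by omega), map_sub, LinearMap.sub_apply, Pi.sub_apply, h3 i hi,
        smul_sub, smul_add, sub_add_eq_sub_sub, sub_eq_add_neg (_ - _), Finset.smul_sum,
        Finset.smul_sum, ← Finset.sum_neg_distrib]
      congr 1
      · congr 1
        · split_ifs <;> simp
        · refine Finset.sum_congr rfl fun s _ => ?_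
          rw [map_nsmul, smul_comm, show k - n + i - s = k - s - n + i by ring]
      · refine Finset.sum_congr rfl fun j _ => ?_
        rw [parity_mode, map_neg, LinearMap.neg_apply, Pi.neg_apply, smul_neg, smul_neg, neg_neg,
          smul_comm, show k - n + i + j + m + 1 = k + j + m + 1 - n + i by ring]
    -- Left side, creation part: contraction occurs exactly when m + s = n, and there C(m+s,m) is
    -- C(n,m).
    have hL : mode B ℓ a n (∑ s ∈ Finset.range N, (m + s).choose m •
          mode B ℓ b (-((m + s : ℕ) : ℤ) - 1) (vertexOp B ℓ u w (k - s)))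
        = (if m ≤ n then n.choose m • (ℓ * B a b) • vertexOp B ℓ u w (k - n + m) else 0)
          - ∑ s ∈ Finset.range N, (m + s).choose m • mode B ℓ b (-((m + s : ℕ) : ℤ) - 1)
            (vertexOp B ℓ (parity B ℓ u) (mode B ℓ a n w) (k - s))
          - ∑ s ∈ Finset.range N, (m + s).choose m • mode B ℓ b (-((m + s : ℕ) : ℤ) - 1)
            (∑ i ∈ Finset.range (n + 1), n.choose i •
              vertexOp B ℓ (mode B ℓ a i u) w (k - s - n + i)) := by
      have e1 : (if m ≤ n then n.choose m • (ℓ * B a b) • vertexOp B ℓ u w (k - n + m) else 0)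
          = ∑ s ∈ Finset.range N, (m + s).choose m •
            (if (n : ℤ) = (m + s : ℕ) then (ℓ * B a b) • vertexOp B ℓ u w (k - s) else 0) := by
        split_ifs with hmn
        -- The bound N ≥ n + 1 guarantees that this index lies in the range.
        · rw [Finset.sum_eq_single (n - m)]
          · rw [Nat.add_sub_cancel' hmn, if_pos rfl]
            rw [show k - ((n - m : ℕ) : ℤ) = k - n + m by omega]
          · intro s _ hs
            rw [if_neg (by omega), smul_zero]
          · intro hs
            rw [Finset.mem_range] at hs
            omega
        · refine (Finset.sum_eq_zero fun s _ => ?_).symm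
          rw [if_neg (by omega), smul_zero]
      rw [e1, map_sum, ← Finset.sum_sub_distrib, ← Finset.sum_sub_distrib]
      refine Finset.sum_congr rfl fun s _ => ?_
      rw [map_nsmul, mode_anticomm B ℓ a b n (by omega), ih, smul_sub, map_add, smul_add,
        sub_add_eq_sub_sub]
    -- Left side, annihilation part: no contraction here, since both modes are nonnegative and
    -- simply anticommute.
    have hC : mode B ℓ a n (∑ j ∈ Finset.range N, Ring.choose (-(j : ℤ) - 1) m •
          vertexOp B ℓ (parity B ℓ u) (mode B ℓ b j w) (k + j + m + 1))
        = -∑ j ∈ Finset.range N, Ring.choose (-(j : ℤ) - 1) m •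
            vertexOp B ℓ u (mode B ℓ b j (mode B ℓ a n w)) (k + j + m + 1)
          + ∑ j ∈ Finset.range N, Ring.choose (-(j : ℤ) - 1) m •
            ∑ i ∈ Finset.range (n + 1), n.choose i •
              vertexOp B ℓ (mode B ℓ a i (parity B ℓ u)) (mode B ℓ b j w)
                (k + j + m + 1 - n + i) := by
      rw [map_sum, ← Finset.sum_neg_distrib, ← Finset.sum_add_distrib]
      refine Finset.sum_congr rfl fun j _ => ?_
      rw [map_zsmul, ih', parity_parity, mode_anticomm_pos B ℓ a b n j (by omega) (by omega),
        map_neg, Pi.neg_apply, smul_add, smul_neg]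
    rw [h1, map_add, hL, hC, parity_mode, map_neg, LinearMap.neg_apply, Pi.neg_apply, h2, hR,
      parity_parity]
    abel
  | add u v hu hv =>
    simp only [map_add, LinearMap.add_apply, Pi.add_apply, hu, hv, smul_add, Finset.sum_add_distrib]
    abel
  | smul c u hu =>
    simp only [map_smul, LinearMap.smul_apply, Pi.smul_apply, hu, smul_add, Finset.smul_sum,
      smul_comm c]

/-! ### The vacuum and the translation operator -/

lemma vertexOp_mode_vac (a : 𝔥) (m : ℕ) (u : Fock B ℓ) (k : ℤ) : ∀ᶠ N : ℕ in Filter.atTop,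
    vertexOp B ℓ (mode B ℓ a (-(m : ℤ) - 1) u) (vac B ℓ) k
      = ∑ s ∈ Finset.range N, (m + s).choose m •
          mode B ℓ a (-((m + s : ℕ) : ℤ) - 1) (vertexOp B ℓ u (vac B ℓ) (k - s)) := by
  filter_upwards [vertexOp_mode B ℓ a m u (vac B ℓ) k] with N hN
  rw [hN, Finset.sum_eq_zero (s := Finset.range N) (f := fun n => Ring.choose (-(n : ℤ) - 1) m • _)
    fun n _ => by
    rw [mode_vac B ℓ a n (by omega), map_zero, Pi.zero_apply, smul_zero], add_zero]

/-- On the vacuum only the creation part of the recursion survives. It has no negative powers of x,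
and its constant term comes from s = 0 with coefficient C(m,m) = 1. -/
theorem vertexOp_creation (u : Fock B ℓ) :
    (∀ n < 0, vertexOp B ℓ u (vac B ℓ) n = 0) ∧ vertexOp B ℓ u (vac B ℓ) 0 = u := by
  induction u using fock_induction with
  | vac =>
    refine ⟨fun n hn => ?_, ?_⟩
    · rw [vertexOp_vac, if_neg hn.ne]
    · rw [vertexOp_vac, if_pos rfl]
  | mode a m u ih =>
    refine ⟨fun k hk => ?_, ?_⟩
    · obtain ⟨N, hN⟩ := (vertexOp_mode_vac B ℓ a m u k).exists
      rw [hN]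
      exact Finset.sum_eq_zero fun s _ => by rw [ih.1 _ (by omega), map_zero, smul_zero]
    · obtain ⟨N, hN, hN1⟩ := ((vertexOp_mode_vac B ℓ a m u 0).and
        (Filter.eventually_ge_atTop 1)).exists
      rw [hN, Finset.sum_eq_single 0]
      · simp [ih.2]
      · intro s _ hs
        rw [ih.1 _ (by omega), map_zero, smul_zero]
      · intro h
        simp at h
        omega
  | add u v hu hv =>
    simp only [map_add, LinearMap.add_apply, Pi.add_apply]
    exact ⟨fun n hn => by rw [hu.1 n hn, hv.1 n hn, add_zero], by rw [hu.2, hv.2]⟩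
  | smul c u hu =>
    simp only [map_smul, LinearMap.smul_apply, Pi.smul_apply]
    exact ⟨fun n hn => by rw [hu.1 n hn, smul_zero], by rw [hu.2]⟩

/-- The translation operator `D`. -/
def translation : Module.End ℂ (Fock B ℓ) :=
  LinearMap.proj 1 ∘ₗ (vertexOp B ℓ).flip (vac B ℓ)

lemma translation_apply (v : Fock B ℓ) : translation B ℓ v = vertexOp B ℓ v (vac B ℓ) 1 := rfl

lemma derivOp_eq (v : Fock B ℓ) : derivOp (vertexOp B ℓ) (vac B ℓ) v = translation B ℓ v := by
  simp [derivOp, formalDeriv, translation_apply]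

lemma translation_vac : translation B ℓ (vac B ℓ) = 0 := by
  rw [translation_apply, vertexOp_vac, if_neg one_ne_zero]

lemma parity_translation (v : Fock B ℓ) :
    parity B ℓ (translation B ℓ v) = translation B ℓ (parity B ℓ v) := by
  rw [translation_apply, translation_apply, parity_vertexOp, parity_vac]

/-- In the coefficient of x only two terms survive: s = 1, with C(m+1,m) = m+1 and the constant term
u, and s = 0, with the linear term Du. -/
lemma translation_mode_neg (a : 𝔥) (m : ℕ) (u : Fock B ℓ) :
    translation B ℓ (mode B ℓ a (-(m : ℤ) - 1) u)
      = (m + 1) • mode B ℓ a (-((m + 1 : ℕ) : ℤ) - 1) u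
        + mode B ℓ a (-(m : ℤ) - 1) (translation B ℓ u) := by
  obtain ⟨N, hN, hN2⟩ := ((vertexOp_mode_vac B ℓ a m u 1).and
    (Filter.eventually_ge_atTop 2)).exists
  obtain ⟨N, rfl⟩ := Nat.exists_eq_add_of_le' hN2
  rw [translation_apply, hN, Finset.sum_range_succ', Finset.sum_range_succ',
    Finset.sum_eq_zero fun s _ => by
      rw [(vertexOp_creation B ℓ u).1 _ (by omega), map_zero, smul_zero]]
  simp [(vertexOp_creation B ℓ u).2, translation_apply]

/-- For n = 0 the extra mode is a creation mode, but its coefficient is zero. For positive n the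
factor n is the one picked up when D raises a creation index to n before contraction. -/
lemma mode_translation (a : 𝔥) (n : ℕ) (v : Fock B ℓ) :
    mode B ℓ a n (translation B ℓ v)
      = translation B ℓ (mode B ℓ a n v) + n • mode B ℓ a ((n : ℤ) - 1) v := by
  refine fock_ext (f := mode B ℓ a n ∘ₗ translation B ℓ)
    (g := translation B ℓ ∘ₗ mode B ℓ a n + n • mode B ℓ a ((n : ℤ) - 1)) ?_ ?_ v
  · rcases n with _ | n
    · simp [translation_vac, mode_vac]
    · simp [translation_vac, mode_vac B ℓ a ((n : ℤ) + 1) (by omega), mode_vac B ℓ a n (by omega)]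
  · intro b j v hv
    simp only [LinearMap.comp_apply, LinearMap.add_apply, LinearMap.smul_apply] at hv ⊢
    rw [translation_mode_neg, map_add, map_nsmul, mode_anticomm B ℓ a b n (by omega),
      mode_anticomm B ℓ a b n (by omega), mode_anticomm B ℓ a b n (by omega), hv, map_sub,
      translation_mode_neg]
    rcases n with _ | n
    · rw [if_neg (by omega)]
      split_ifs <;> simp <;> abel
    · rw [show ((n + 1 : ℕ) : ℤ) - 1 = n by push_cast; ring, mode_anticomm B ℓ a b n (by omega)]
      -- The contraction with the raised creation mode and that of the lowered annihilation mode
      -- occur for the same index j.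
      have e : (((n + 1 : ℕ) : ℤ) = (j + 1 : ℕ)) ↔ ((n : ℤ) = j) := by omega
      simp only [e, map_add, map_nsmul, smul_sub]
      by_cases hnj : n = j
      · subst hnj
        simp
        abel
      · simp only [Nat.cast_inj, if_neg hnj]
        split_ifs <;> simp <;> abel

end Fock

section Fock

variable {𝔥 : Type*} [AddCommGroup 𝔥] [Module ℂ 𝔥] (B : LinearMap.BilinForm ℂ 𝔥) (ℓ : ℂ)

/-- D replaces a(-m-1/2)u by (m+1)a(-m-3/2)u + a(-m-1/2)Du. Applying the recursion with m+1 and with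
m, both parts reduce to (m+1)C(r,m+1) = (r-m)C(r,m). -/
theorem vertexOp_translation (v w : Fock B ℓ) (k : ℤ) :
    vertexOp B ℓ (translation B ℓ v) w k = (k + 1) • vertexOp B ℓ v w (k + 1) := by
  induction v using fock_induction_parity generalizing w k with
  | vac =>
    rw [translation_vac, map_zero, LinearMap.zero_apply, Pi.zero_apply, vertexOp_vac]
    split_ifs with h
    · rw [h, zero_smul]
    · rw [smul_zero]
  | mode a m u ih ih' =>
    obtain ⟨N, ⟨h1, h2⟩, h3, h4⟩ := (((vertexOp_mode B ℓ a m u w (k + 1)).and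
      (vertexOp_mode B ℓ a (m + 1) u w k)).and
      ((vertexOp_mode B ℓ a m (translation B ℓ u) w k).and
      (eventually_vertexOp_eq_zero B ℓ u w (k + 1)))).exists
    -- The shift of index costs nothing: C(m,m+1) = 0 at the lower end, and truncation of Y(u,x)w
    -- kills the upper end.
    have hs := sum_range_shift (fun s : ℕ => ((m + 1) * (m + s).choose (m + 1)) •
      mode B ℓ a (-((m + s : ℕ) : ℤ) - 1) (vertexOp B ℓ u w (k + 1 - s))) N (by simp)
      (by simp [h4])
    have hs' : (m + 1) • ∑ s ∈ Finset.range N, (m + 1 + s).choose (m + 1) •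
          mode B ℓ a (-((m + 1 + s : ℕ) : ℤ) - 1) (vertexOp B ℓ u w (k - s))
        = ∑ s ∈ Finset.range N, ((m + 1) * (m + s).choose (m + 1)) •
      mode B ℓ a (-((m + s : ℕ) : ℤ) - 1) (vertexOp B ℓ u w (k + 1 - s)) := by
      rw [← hs, Finset.smul_sum]
      refine Finset.sum_congr rfl fun s _ => ?_
      rw [smul_smul, show m + (s + 1) = m + 1 + s by ring,
        show k + 1 - ((s + 1 : ℕ) : ℤ) = k - s by push_cast; ring]
    rw [translation_mode_neg, map_add, map_nsmul, LinearMap.add_apply, LinearMap.smul_apply,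
      Pi.add_apply, Pi.smul_apply, h1, h2, h3, smul_add, smul_add, hs', add_add_add_comm,
      Finset.smul_sum, Finset.smul_sum, Finset.smul_sum, ← Finset.sum_add_distrib,
      ← Finset.sum_add_distrib]
    congr 1
    · refine Finset.sum_congr rfl fun s _ => ?_
      rw [ih, map_zsmul, show k - s + 1 = k + 1 - s by ring, ← natCast_zsmul, ← natCast_zsmul,
        ← natCast_zsmul, smul_smul, smul_smul, ← add_smul]
      congr 1
      have := succ_mul_choose_succ (m + s : ℕ) m
      rw [Ring.choose_natCast, Ring.choose_natCast] at this
      push_cast at this ⊢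
      rw [this]
      ring
    · refine Finset.sum_congr rfl fun n _ => ?_
      rw [parity_translation, ih', ← natCast_zsmul, smul_smul, smul_smul, smul_smul,
        show k + 1 + n + m + 1 = k + n + m + 1 + 1 by ring,
        show k + n + ((m + 1 : ℕ) : ℤ) + 1 = k + n + m + 1 + 1 by push_cast; ring, ← add_smul]
      congr 1
      have := succ_mul_choose_succ (-(n : ℤ) - 1) m
      push_cast
      rw [this]
      ring
  | add u v hu hv =>
    simp only [map_add, LinearMap.add_apply, Pi.add_apply, hu, hv, smul_add]
  | smul c u hu =>
    simp only [map_smul, LinearMap.smul_apply, Pi.smul_apply, hu, smul_comm c]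

/-- The commutator of D with a mode moves the mode index by one. After reindexing, these
contributions combine with the derivative of Y(u,x) or Y(Pu,x) into the factor k+1. -/
theorem translation_vertexOp (v w : Fock B ℓ) (k : ℤ) :
    translation B ℓ (vertexOp B ℓ v w k)
      = vertexOp B ℓ v (translation B ℓ w) k + (k + 1) • vertexOp B ℓ v w (k + 1) := by
  induction v using fock_induction_parity generalizing w k with
  | vac =>
    rw [vertexOp_vac, vertexOp_vac, vertexOp_vac]
    have : (k + 1) • (if k + 1 = 0 then w else 0) = 0 := by
      split_ifs with h
      · rw [h, zero_smul]
      · rw [smul_zero]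
    rw [this]
    split_ifs <;> simp
  | mode a m u ih ih' =>
    obtain ⟨N, ⟨h1, h2⟩, h3, h4, h5⟩ := (((vertexOp_mode B ℓ a m u w k).and
      (vertexOp_mode B ℓ a m u w (k + 1))).and
      ((vertexOp_mode B ℓ a m u (translation B ℓ w) k).and
      ((eventually_vertexOp_eq_zero B ℓ u w (k + 1)).and
      ((Filter.tendsto_sub_atTop_nat 1).eventually (eventually_mode_eq_zero B ℓ w))))).exists
    -- Reindexing for the creation part: the factor s kills the lower end, truncation the upper end.
    have hs := sum_range_shift (fun s : ℕ => (s * (m + s).choose m) •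
      mode B ℓ a (-((m + s : ℕ) : ℤ) - 1) (vertexOp B ℓ u w (k + 1 - s))) N (by simp)
      (by simp [h4])
    -- Reindexing for the annihilation part: the factor n kills the lower end, and at the upper end
    -- the mode of index N-1 kills w. This is why the vanishing of modes is requested at N-1.
    have ht := sum_range_shift (fun n : ℕ => ((n : ℤ) * Ring.choose (-(n : ℤ) - 1) m) •
      vertexOp B ℓ (parity B ℓ u) (mode B ℓ a ((n : ℤ) - 1) w) (k + n + m + 1)) N (by simp) (by
        rcases N with _ | N
        · simp
        · have := h5 a
          rw [show ((N + 1 : ℕ) : ℤ) - 1 = (N + 1 - 1 : ℕ) by push_cast; omega, this]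
          simp)
    have hs' : translation B ℓ (∑ s ∈ Finset.range N, (m + s).choose m •
          mode B ℓ a (-((m + s : ℕ) : ℤ) - 1) (vertexOp B ℓ u w (k - s)))
        = ∑ s ∈ Finset.range N, (m + s).choose m •
            mode B ℓ a (-((m + s : ℕ) : ℤ) - 1) (vertexOp B ℓ u (translation B ℓ w) (k - s))
          + (k + 1) • ∑ s ∈ Finset.range N, (m + s).choose m •
            mode B ℓ a (-((m + s : ℕ) : ℤ) - 1) (vertexOp B ℓ u w (k + 1 - s)) := by
      have e : (k + 1) • ∑ s ∈ Finset.range N, (m + s).choose m •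
            mode B ℓ a (-((m + s : ℕ) : ℤ) - 1) (vertexOp B ℓ u w (k + 1 - s))
          = ∑ s ∈ Finset.range N, (s * (m + s).choose m) •
            mode B ℓ a (-((m + s : ℕ) : ℤ) - 1) (vertexOp B ℓ u w (k + 1 - s))
          + ∑ s ∈ Finset.range N, ((k + 1 - s) * (m + s).choose m) •
            mode B ℓ a (-((m + s : ℕ) : ℤ) - 1) (vertexOp B ℓ u w (k + 1 - s)) := by
        rw [Finset.smul_sum, ← Finset.sum_add_distrib]
        refine Finset.sum_congr rfl fun s _ => ?_
        rw [← natCast_zsmul, ← natCast_zsmul, smul_smul, ← add_smul]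
        congr 1
        push_cast
        ring
      rw [e, ← hs, map_sum, ← Finset.sum_add_distrib, ← Finset.sum_add_distrib]
      refine Finset.sum_congr rfl fun s _ => ?_
      have hC : (s + 1) * (m + (s + 1)).choose m = (m + s).choose m * (m + s + 1) := by
        rw [← add_assoc, Nat.choose_mul_succ_eq, mul_comm, show m + s + 1 - m = s + 1 by omega]
      rw [map_nsmul, translation_mode_neg, ih, map_add, map_zsmul, smul_add, smul_add, hC, mul_smul,
        mul_smul, natCast_zsmul, smul_comm ((m + s).choose m) (k - s + 1),
        show k - s + 1 = k + 1 - s by ring,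
        show k + 1 - ((s + 1 : ℕ) : ℤ) = k - s by push_cast; ring, ← add_assoc m s 1]
      abel
    have ht' : translation B ℓ (∑ n ∈ Finset.range N, Ring.choose (-(n : ℤ) - 1) m •
          vertexOp B ℓ (parity B ℓ u) (mode B ℓ a n w) (k + n + m + 1))
        = ∑ n ∈ Finset.range N, Ring.choose (-(n : ℤ) - 1) m •
            vertexOp B ℓ (parity B ℓ u) (mode B ℓ a n (translation B ℓ w)) (k + n + m + 1)
          + (k + 1) • ∑ n ∈ Finset.range N, Ring.choose (-(n : ℤ) - 1) m •
            vertexOp B ℓ (parity B ℓ u) (mode B ℓ a n w) (k + 1 + n + m + 1) := by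
      have e : ∑ n ∈ Finset.range N, Ring.choose (-(n : ℤ) - 1) m •
            vertexOp B ℓ (parity B ℓ u) (mode B ℓ a n (translation B ℓ w)) (k + n + m + 1)
          = ∑ n ∈ Finset.range N, Ring.choose (-(n : ℤ) - 1) m •
            vertexOp B ℓ (parity B ℓ u) (translation B ℓ (mode B ℓ a n w)) (k + n + m + 1)
          + ∑ n ∈ Finset.range N, ((n : ℤ) * Ring.choose (-(n : ℤ) - 1) m) •
            vertexOp B ℓ (parity B ℓ u) (mode B ℓ a ((n : ℤ) - 1) w) (k + n + m + 1) := by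
        rw [← Finset.sum_add_distrib]
        refine Finset.sum_congr rfl fun n _ => ?_
        rw [mode_translation, map_add, map_nsmul, Pi.add_apply, Pi.smul_apply, smul_add, mul_comm,
          mul_smul, natCast_zsmul]
      rw [e, ← ht, map_sum, Finset.smul_sum, ← Finset.sum_add_distrib, ← Finset.sum_add_distrib]
      refine Finset.sum_congr rfl fun n _ => ?_
      rw [map_zsmul, ih', smul_add]
      refine (congrArg₂ _ rfl ?_).trans (add_assoc _ _ _).symm
      rw [show ((n + 1 : ℕ) : ℤ) - 1 = n by push_cast; ring,
        show k + ((n + 1 : ℕ) : ℤ) + m + 1 = k + n + m + 1 + 1 by push_cast; ring,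
        show k + 1 + n + m + 1 = k + n + m + 1 + 1 by ring, smul_smul, smul_smul, ← add_smul]
      congr 1
      have := mul_choose_sub_one (-(n : ℤ) - 1) m
      push_cast
      rw [show -((n : ℤ) + 1) - 1 = -(n : ℤ) - 1 - 1 by ring]
      linear_combination this
    rw [h1, h2, h3, map_add, hs', ht', smul_add]
    abel
  | add u v hu hv =>
    simp only [map_add, LinearMap.add_apply, Pi.add_apply, hu, hv, smul_add]
    abel
  | smul c u hu =>
    simp only [map_smul, LinearMap.smul_apply, Pi.smul_apply, hu, smul_comm c, smul_add]

/-! ### The weight operator -/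

variable (hA : DirectSum.IsInternal (weightSpace B ℓ))

lemma weightOp_vac : weightOp (weightSpace B ℓ) hA (vac B ℓ) = 0 := by
  rw [weightOp_of_mem B ℓ hA (vac_mem_weightSpace B ℓ)]
  simp

lemma parity_weightOp (v : Fock B ℓ) : parity B ℓ (weightOp (weightSpace B ℓ) hA v)
    = weightOp (weightSpace B ℓ) hA (parity B ℓ v) := by
  refine fock_ext (f := parity B ℓ ∘ₗ weightOp (weightSpace B ℓ) hA)
    (g := weightOp (weightSpace B ℓ) hA ∘ₗ parity B ℓ) ?_ ?_ v
  · simp [weightOp_vac, parity_vac]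
  · intro a m v hv
    simp only [LinearMap.comp_apply] at hv ⊢
    rw [weightOp_mode, map_sub, map_smul, parity_mode, parity_mode, hv, map_neg, weightOp_mode]
    simp [sub_eq_add_neg, add_comm]

/-- In each summand the weight of the mode and the exponent at which Y(u,x) or Y(Pu,x) is evaluated
add up to k + m + 1/2, independently of the summation index: k from the exponent of x, and m + 1/2
from a(-m-1/2). -/
theorem weightOp_vertexOp (v w : Fock B ℓ) (k : ℤ) :
    weightOp (weightSpace B ℓ) hA (vertexOp B ℓ v w k)
      = vertexOp B ℓ v (weightOp (weightSpace B ℓ) hA w) k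
        + (k : ℂ) • vertexOp B ℓ v w k + vertexOp B ℓ (weightOp (weightSpace B ℓ) hA v) w k := by
  induction v using fock_induction_parity generalizing w k with
  | vac =>
    rw [weightOp_vac, map_zero, LinearMap.zero_apply, Pi.zero_apply, vertexOp_vac, vertexOp_vac]
    split_ifs with h <;> simp [h]
  | mode a m u ih ih' =>
    obtain ⟨N, h1, h2, h3⟩ := ((vertexOp_mode B ℓ a m u w k).and
      ((vertexOp_mode B ℓ a m u (weightOp (weightSpace B ℓ) hA w) k).and
      (vertexOp_mode B ℓ a m (weightOp (weightSpace B ℓ) hA u) w k))).exists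
    rw [weightOp_mode, map_sub, map_smul, LinearMap.sub_apply, LinearMap.smul_apply, Pi.sub_apply,
      Pi.smul_apply, h1, h2, h3, map_add, map_sum, map_sum]
    have e1 : ∀ s : ℕ, weightOp (weightSpace B ℓ) hA ((m + s).choose m •
          mode B ℓ a (-((m + s : ℕ) : ℤ) - 1) (vertexOp B ℓ u w (k - s)))
        = (m + s).choose m • mode B ℓ a (-((m + s : ℕ) : ℤ) - 1)
            (vertexOp B ℓ u (weightOp (weightSpace B ℓ) hA w) (k - s))
          + ((k : ℂ) + m + 1 / 2) • (m + s).choose m •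
            mode B ℓ a (-((m + s : ℕ) : ℤ) - 1) (vertexOp B ℓ u w (k - s))
          + (m + s).choose m • mode B ℓ a (-((m + s : ℕ) : ℤ) - 1)
            (vertexOp B ℓ (weightOp (weightSpace B ℓ) hA u) w (k - s)) := fun s => by
      rw [map_nsmul, weightOp_mode, ih, map_add, map_add, map_smul]
      push_cast
      module
    have e2 : ∀ n : ℕ, weightOp (weightSpace B ℓ) hA (Ring.choose (-(n : ℤ) - 1) m •
          vertexOp B ℓ (parity B ℓ u) (mode B ℓ a n w) (k + n + m + 1))
        = Ring.choose (-(n : ℤ) - 1) m • vertexOp B ℓ (parity B ℓ u)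
            (mode B ℓ a n (weightOp (weightSpace B ℓ) hA w)) (k + n + m + 1)
          + ((k : ℂ) + m + 1 / 2) • Ring.choose (-(n : ℤ) - 1) m •
            vertexOp B ℓ (parity B ℓ u) (mode B ℓ a n w) (k + n + m + 1)
          + Ring.choose (-(n : ℤ) - 1) m • vertexOp B ℓ
            (parity B ℓ (weightOp (weightSpace B ℓ) hA u)) (mode B ℓ a n w) (k + n + m + 1) :=
        fun n => by
      rw [map_zsmul, ih', weightOp_mode, map_sub, map_smul, Pi.sub_apply, Pi.smul_apply,
        parity_weightOp]
      push_cast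
      module
    simp only [e1, e2, Finset.sum_add_distrib, ← Finset.smul_sum]
    push_cast
    module
  | add u v hu hv =>
    simp only [map_add, LinearMap.add_apply, Pi.add_apply, hu, hv, smul_add]
    abel
  | smul c u hu =>
    simp only [map_smul, LinearMap.smul_apply, Pi.smul_apply, hu, smul_comm c, smul_add]

end Fock

/-! ### Operators on formal series in two variables -/

section Series

/-- Coefficientwise stabilization of a sequence of series. -/
def Stabilizes {V : Type*} (G : ℕ → ℤ → ℤ → V) (f : ℤ → ℤ → V) : Prop :=
  ∀ a b, ∀ᶠ L in Filter.atTop, f a b = G L a b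

lemma Stabilizes.unique {V : Type*} {G : ℕ → ℤ → ℤ → V} {f g : ℤ → ℤ → V} (hf : Stabilizes G f)
    (hg : Stabilizes G g) : f = g := by
  refine funext fun a => funext fun b => ?_
  obtain ⟨L, h1, h2⟩ := ((hf a b).and (hg a b)).exists
  rw [h1, h2]

variable {V : Type*} [AddCommGroup V]

/-- The common form of the Pascal-type arguments below: multiplication by a variable shortens the
truncated range by one, which is absorbed by shifting the index. -/
lemma sum_range_toNat_add (d : ℤ) (A A' C : ℕ → V) (h0 : C 0 = A 0)
    (hs : ∀ i, C (i + 1) = A (i + 1) + A' i) :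
    ∑ i ∈ Finset.range d.toNat, A i + ∑ i ∈ Finset.range (d - 1).toNat, A' i
      = ∑ i ∈ Finset.range d.toNat, C i := by
  rcases le_or_gt d 0 with hd | hd
  · rw [Int.toNat_of_nonpos hd, Int.toNat_of_nonpos (by omega)]
    simp
  · obtain ⟨n, hn⟩ : ∃ n, d.toNat = n + 1 := ⟨d.toNat - 1, by omega⟩
    rw [hn, show (d - 1).toNat = n by omega, Finset.sum_range_succ', Finset.sum_range_succ' C,
      add_right_comm, ← Finset.sum_add_distrib, h0]
    simp only [hs]

/-- Multiplication by `(x₁ - x₂)⁻ᵠ`, expanded in nonnegative powers of `x₂`, of a series in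
`x₁`, `x₂` with exponents of `x₂` greater than `N`. -/
def divSub (N : ℤ) (q : ℕ) (f : ℤ → ℤ → V) : ℤ → ℤ → V := fun c b =>
  ∑ l ∈ Finset.range (b - N).toNat, q.multichoose l • f (c + q + l) (b - l)

lemma divSub_zero (N : ℤ) (f : ℤ → ℤ → V) (hf : ∀ c, ∀ b ≤ N, f c b = 0) : divSub N 0 f = f := by
  refine funext fun c => funext fun b => ?_
  rw [divSub]
  rcases le_or_gt b N with hb | hb
  · rw [Int.toNat_of_nonpos (by omega), hf c b hb]
    simp
  · obtain ⟨n, hn⟩ : ∃ n, (b - N).toNat = n + 1 := ⟨(b - N).toNat - 1, by omega⟩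
    rw [hn, Finset.sum_range_succ']
    simp

/-- Multiplication by `(x₂ + x₀)⁻ᵠ`, expanded in nonnegative powers of `x₀`, of a series in
`x₀`, `x₂` with exponents of `x₀` greater than `M`. -/
def divAdd (M : ℤ) (q : ℕ) (f : ℤ → ℤ → V) : ℤ → ℤ → V := fun a b =>
  ∑ s ∈ Finset.range (a - M).toNat, Ring.choose (-(q : ℤ)) s • f (a - s) (b + q + s)

lemma divAdd_zero (M : ℤ) (f : ℤ → ℤ → V) (hf : ∀ a ≤ M, ∀ b, f a b = 0) : divAdd M 0 f = f := by
  refine funext fun a => funext fun b => ?_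
  rw [divAdd]
  rcases le_or_gt a M with ha | ha
  · rw [Int.toNat_of_nonpos (by omega), hf a ha b]
    simp
  · obtain ⟨n, hn⟩ : ∃ n, (a - M).toNat = n + 1 := ⟨(a - M).toNat - 1, by omega⟩
    rw [hn, Finset.sum_range_succ']
    simp [Ring.choose_zero_succ]

/-- A sum over diagonals j = s + t becomes a sum over a rectangle. The bound R is demanded only for
s < S, as it will be chosen uniformly over finitely many s. -/
lemma eventually_sum_diag (g : ℕ → ℕ → V) (S R : ℕ) (hS : ∀ s t, S ≤ s → g s t = 0)
    (hR : ∀ s t, s < S → R ≤ t → g s t = 0) : ∀ᶠ L : ℕ in Filter.atTop,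
    ∑ j ∈ Finset.range L, ∑ s ∈ Finset.range (j + 1), g s (j - s)
      = ∑ s ∈ Finset.range S, ∑ t ∈ Finset.range R, g s t := by
  filter_upwards [Filter.eventually_ge_atTop (S + R)] with L hL
  rw [Finset.sum_range_diag_flip]
  refine (Finset.sum_subset (Finset.range_mono (by omega)) fun s _ hs => ?_).symm.trans
    (Finset.sum_congr rfl fun s hs => ?_)
  · exact Finset.sum_eq_zero fun t _ => hS s t (by simpa using hs)
  · rw [Finset.mem_range] at hs
    exact (Finset.sum_subset (Finset.range_mono (by omega)) fun t _ ht =>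
      hR s t hs (by simpa using ht)).symm

variable [Module ℂ V]

/-- Multiplication by `x₀ⁱ x₂ʲ`. -/
def shift (i j : ℤ) : Module.End ℂ (ℤ → ℤ → V) where
  toFun f a b := f (a - i) (b - j)
  map_add' _ _ := rfl
  map_smul' _ _ := rfl

@[simp] lemma shift_apply (i j : ℤ) (f : ℤ → ℤ → V) (a b : ℤ) :
    shift i j f a b = f (a - i) (b - j) := rfl

lemma shift_mul (i j i' j' : ℤ) :
    (shift i j * shift i' j' : Module.End ℂ (ℤ → ℤ → V)) = shift (i + i') (j + j') := by
  refine LinearMap.ext fun f => funext fun a => funext fun b => ?_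
  simp [Module.End.mul_apply, sub_sub]

lemma shift_shift (i j i' j' : ℤ) (f : ℤ → ℤ → V) :
    shift i j (shift i' j' f) = shift (i + i') (j + j') f :=
  LinearMap.congr_fun (shift_mul i j i' j') f

lemma shift_zero : (shift 0 0 : Module.End ℂ (ℤ → ℤ → V)) = 1 := by
  refine LinearMap.ext fun f => funext fun a => funext fun b => ?_
  simp

lemma shift_pow (i j : ℤ) (n : ℕ) :
    (shift i j : Module.End ℂ (ℤ → ℤ → V)) ^ n = shift (n * i) (n * j) := by
  induction n with
  | zero => simp [shift_zero]
  | succ n ih =>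
    rw [pow_succ, ih, shift_mul]
    congr 1 <;> push_cast <;> ring

lemma shift_commute (i j i' j' : ℤ) :
    Commute (shift i j : Module.End ℂ (ℤ → ℤ → V)) (shift i' j') := by
  rw [Commute, SemiconjBy, shift_mul, shift_mul, add_comm, add_comm j]

/-- Multiplication by `x₀ + x₂`. -/
def mulAdd : Module.End ℂ (ℤ → ℤ → V) := shift 1 0 + shift 0 1

lemma mulAdd_apply (f : ℤ → ℤ → V) (a b : ℤ) : mulAdd f a b = f (a - 1) b + f a (b - 1) := by
  simp [mulAdd]

lemma shift_add_pow_apply (i j i' j' : ℤ) (p : ℕ) (f : ℤ → ℤ → V) (a b : ℤ) :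
    ((shift i j + shift i' j' : Module.End ℂ (ℤ → ℤ → V)) ^ p) f a b
      = ∑ s ∈ Finset.range (p + 1), p.choose s •
        f (a - (s * i + (p - s : ℕ) * i')) (b - (s * j + (p - s : ℕ) * j')) := by
  rw [(shift_commute i j i' j').add_pow, LinearMap.sum_apply, Finset.sum_apply, Finset.sum_apply]
  refine Finset.sum_congr rfl fun s _ => ?_
  rw [shift_pow, shift_pow, shift_mul, ← nsmul_eq_mul', LinearMap.smul_apply]
  rfl

lemma mulAdd_pow_apply (p : ℕ) (f : ℤ → ℤ → V) (a b : ℤ) :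
    (mulAdd ^ p) f a b
      = ∑ s ∈ Finset.range (p + 1), p.choose s • f (a - s) (b - (p - s : ℕ)) := by
  rw [mulAdd, shift_add_pow_apply]
  simp

lemma mulAddPow_eq (p : ℕ) (f : ℤ → ℤ → V) : mulAddPow p f = (mulAdd ^ p) f := by
  refine funext fun a => funext fun b => ?_
  rw [mulAdd, add_comm, shift_add_pow_apply, mulAddPow]
  simp

lemma mulAdd_commute_shift (i j : ℤ) : Commute (mulAdd : Module.End ℂ (ℤ → ℤ → V)) (shift i j) :=
  (shift_commute 1 0 i j).add_left (shift_commute 0 1 i j)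

/-- The application of an operator to every coefficient. -/
def mapCoeff (φ : Module.End ℂ V) : Module.End ℂ (ℤ → ℤ → V) where
  toFun f a b := φ (f a b)
  map_add' _ _ := funext fun _ => funext fun _ => map_add φ _ _
  map_smul' _ _ := funext fun _ => funext fun _ => map_smul φ _ _

@[simp] lemma mapCoeff_apply (φ : Module.End ℂ V) (f : ℤ → ℤ → V) (a b : ℤ) :
    mapCoeff φ f a b = φ (f a b) := rfl

lemma shift_commute_mapCoeff (i j : ℤ) (φ : Module.End ℂ V) :
    Commute (shift i j) (mapCoeff φ) := rfl

lemma mulAdd_commute_mapCoeff (φ : Module.End ℂ V) : Commute mulAdd (mapCoeff φ) :=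
  (shift_commute_mapCoeff 1 0 φ).add_left (shift_commute_mapCoeff 0 1 φ)

/-- The substitution `x₁ = x₀ + x₂` in a series in `x₁`, `x₂` with exponents of `x₂` greater
than `N`. -/
def subst (N : ℤ) : Module.End ℂ (ℤ → ℤ → V) where
  toFun f a b := ∑ i ∈ Finset.range (b - N).toNat, Ring.choose (a + (i : ℤ)) i • f (a + i) (b - i)
  map_add' f g := funext fun a => funext fun b => by
    simp only [Pi.add_apply, smul_add, Finset.sum_add_distrib]
  map_smul' c f := funext fun a => funext fun b => by
    simp only [Pi.smul_apply, RingHom.id_apply, Finset.smul_sum, smul_comm c]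

lemma subst_apply (N : ℤ) (f : ℤ → ℤ → V) (a b : ℤ) : subst N f a b
    = ∑ i ∈ Finset.range (b - N).toNat, Ring.choose (a + (i : ℤ)) i • f (a + i) (b - i) := rfl

/-- The substitution turns multiplication by x₁ into multiplication by x₀+x₂; on coefficients this
is Pascal's rule. -/
lemma subst_mul_shift (N : ℤ) :
    (subst N * shift 1 0 : Module.End ℂ (ℤ → ℤ → V)) = mulAdd * subst N := by
  refine LinearMap.ext fun f => funext fun a => funext fun b => ?_
  rw [Module.End.mul_apply, Module.End.mul_apply, mulAdd_apply, subst_apply, subst_apply,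
    subst_apply, show b - 1 - N = b - N - 1 by ring]
  refine (sum_range_toNat_add _ _ _ _ ?_ fun i => ?_).symm
  · simp
  · rw [shift_apply, show a - 1 + ((i + 1 : ℕ) : ℤ) = a + i by push_cast; ring,
      show a + ((i + 1 : ℕ) : ℤ) = a + i + 1 by push_cast; ring,
      show a + i + 1 - 1 = a + i by ring, sub_zero,
      show b - ((i + 1 : ℕ) : ℤ) = b - 1 - i by push_cast; ring, ← add_smul,
      Ring.choose_succ_succ, add_comm]

lemma subst_mul_shift_pow (N : ℤ) (s : ℕ) :
    (subst N * shift 1 0 ^ s : Module.End ℂ (ℤ → ℤ → V)) = mulAdd ^ s * subst N :=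
  (SemiconjBy.pow_right (a := subst N) (x := shift 1 0) (y := mulAdd) (subst_mul_shift N) s)

/-- The substitution of the product has one more term than the product of the substitution; the
extra term reads f at exponent exactly N, hence the hypothesis there. -/
lemma subst_shift_two (N : ℤ) (f : ℤ → ℤ → V) (hf : ∀ c, f c N = 0) :
    subst N (shift 0 1 f) = shift 0 1 (subst N f) := by
  refine funext fun a => funext fun b => ?_
  rw [shift_apply, subst_apply, subst_apply, sub_zero]
  rcases le_or_gt b N with hb | hb
  · rw [Int.toNat_of_nonpos (by omega), Int.toNat_of_nonpos (by omega)]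
    simp
  · obtain ⟨n, hn⟩ : ∃ n, (b - N).toNat = n + 1 := ⟨(b - N).toNat - 1, by omega⟩
    rw [hn, show (b - 1 - N).toNat = n by omega, Finset.sum_range_succ, shift_apply,
      show b - (n : ℤ) - 1 = N by omega, hf, smul_zero, add_zero]
    refine Finset.sum_congr rfl fun i _ => ?_
    rw [shift_apply, sub_zero, sub_right_comm]

lemma subst_mapCoeff (N : ℤ) (φ : Module.End ℂ V) : Commute (subst N) (mapCoeff φ) := by
  refine LinearMap.ext fun f => funext fun a => funext fun b => ?_
  simp only [Module.End.mul_apply, subst_apply, mapCoeff_apply, map_sum, map_zsmul]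

/-- This is (x₁-x₂)·(x₁-x₂)^{-q-1} = (x₁-x₂)^{-q} with the x₂ term moved to the right, so that both
sides are compared by Pascal's rule for multisets. -/
lemma shift_divSub (N : ℤ) (q : ℕ) (f : ℤ → ℤ → V) :
    shift 1 0 (divSub N (q + 1) f) = divSub N q f + shift 0 1 (divSub N (q + 1) f) := by
  refine funext fun c => funext fun b => ?_
  rw [Pi.add_apply, Pi.add_apply, shift_apply, shift_apply]
  simp only [divSub]
  rw [sub_zero, sub_zero, show b - 1 - N = b - N - 1 by ring]
  refine (sum_range_toNat_add _ _ _ _ ?_ fun i => ?_).symm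
  · simp only [Nat.multichoose_zero_right]
    congr 2
    push_cast
    ring
  · rw [Nat.multichoose_succ_succ, add_smul]
    congr 3 <;> push_cast <;> ring

/-- Since x₁-x₂ becomes x₀, its inverse powers become honest monomials. In the induction
`shift_divSub` is substituted, and the terms with factor x₂ cancel, leaving multiplication by x₀ to
be inverted. -/
lemma subst_divSub (N : ℤ) (q : ℕ) (f : ℤ → ℤ → V) (hf : ∀ c, ∀ b ≤ N, f c b = 0) :
    subst N (divSub N q f) = shift (-q) 0 (subst N f) := by
  induction q with
  | zero => rw [divSub_zero N f hf, Nat.cast_zero, neg_zero, shift_zero]; rfl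
  | succ q ih =>
    have h1 := congrArg (subst N) (shift_divSub N q f)
    have h2 := LinearMap.congr_fun (subst_mul_shift N) (divSub N (q + 1) f)
    rw [Module.End.mul_apply, Module.End.mul_apply] at h2
    rw [h2, map_add, ih, subst_shift_two N _ fun c => by simp [divSub], mulAdd,
      LinearMap.add_apply] at h1
    have h3 := congrArg (shift (-1) 0) (add_right_cancel h1)
    rw [shift_shift, shift_shift, neg_add_cancel, add_zero, shift_zero, Module.End.one_apply] at h3
    rw [h3]
    congr 2
    push_cast
    ring

/-- Pascal's rule for C(-q-1, s). Iterated, it clears a pole in x₂+x₀, whichever way that pole was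
expanded. -/
lemma mulAdd_divAdd (M : ℤ) (q : ℕ) (f : ℤ → ℤ → V) :
    mulAdd (divAdd M (q + 1) f) = divAdd M q f := by
  refine funext fun a => funext fun b => ?_
  rw [mulAdd_apply, add_comm]
  simp only [divAdd]
  rw [show a - 1 - M = a - M - 1 by ring]
  refine sum_range_toNat_add _ _ _ _ ?_ fun i => ?_
  · simp
  · have := Ring.choose_succ_succ (-((q + 1 : ℕ) : ℤ)) i
    rw [show -((q + 1 : ℕ) : ℤ) + 1 = -(q : ℤ) by push_cast; ring] at this
    rw [this, add_comm, add_smul]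
    congr 3 <;> push_cast <;> ring

lemma mulAdd_pow_divAdd (M : ℤ) (q : ℕ) (f : ℤ → ℤ → V) (hf : ∀ a ≤ M, ∀ b, f a b = 0) :
    (mulAdd ^ q) (divAdd M q f) = f := by
  induction q with
  | zero => rw [divAdd_zero M f hf]; rfl
  | succ q ih => rw [pow_succ, Module.End.mul_apply, mulAdd_divAdd, ih]

lemma Stabilizes.subst {G : ℕ → ℤ → ℤ → V} {f : ℤ → ℤ → V} (h : Stabilizes G f) (N : ℤ) :
    Stabilizes (fun L => subst N (G L)) (FermionicMOSVA.subst N f) := by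
  intro a b
  filter_upwards [(Filter.eventually_all_finset (Finset.range (b - N).toNat)).2
    fun i _ => h (a + i) (b - i)] with L hL
  rw [subst_apply, subst_apply]
  exact Finset.sum_congr rfl fun i hi => by rw [hL i hi]

lemma Stabilizes.mulAdd_pow {G : ℕ → ℤ → ℤ → V} {f : ℤ → ℤ → V} (h : Stabilizes G f) (p : ℕ) :
    Stabilizes (fun L => (mulAdd ^ p) (G L)) ((mulAdd ^ p) f) := by
  intro a b
  filter_upwards [(Filter.eventually_all_finset (Finset.range (p + 1))).2
    fun s _ => h (a - s) (b - (p - s : ℕ))] with L hL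
  rw [mulAdd_pow_apply, mulAdd_pow_apply]
  exact Finset.sum_congr rfl fun i hi => by rw [hL i hi]

/-- Any N below the exponents of Y(u₂,x)v works, so N may later be lowered to serve several products
at once. -/
lemma productSeries_eq_subst (Y : V →ₗ[ℂ] V →ₗ[ℂ] (ℤ → V)) (u₁ u₂ v : V) (N : ℤ)
    (hN : ∀ b ≤ N, Y u₂ v b = 0) :
    productSeries Y u₁ u₂ v = subst N fun c b => Y u₁ (Y u₂ v b) c := by
  refine funext fun a => funext fun b => ?_
  rw [productSeries, subst_apply]
  refine finsum_eq_sum_of_support_subset _ fun i hi => ?_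
  rw [Finset.coe_range, Set.mem_Iio]
  by_contra hlt
  refine hi ?_
  simp only
  rw [hN _ (by omega), map_zero, Pi.zero_apply, smul_zero]

end Series

/-! ### Weak associativity -/

lemma choose_neg_sub_one (n m : ℕ) :
    Ring.choose (-(n : ℤ) - 1) m = Int.negOnePow m • ((n + m).choose m : ℤ) := by
  rw [show -(n : ℤ) - 1 = -((n : ℤ) + 1) by ring, Ring.choose_neg,
    show (n : ℤ) + 1 + m - 1 = ((n + m : ℕ) : ℤ) by push_cast; ring, Ring.choose_natCast]

/-- Both sides equal (-1)^m (i+l+m)!/(i! l! m!). The identity lets the sum over n = i + l with fixed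
i be recognized as a multiple of the expansion of (x₁-x₂)^{-i-m-1}. -/
lemma choose_neg_mul_choose (i l m : ℕ) :
    Ring.choose (-((i + l : ℕ) : ℤ) - 1) m * ((i + l).choose i : ℤ)
      = Ring.choose (-(i : ℤ) - 1) m * ((i + m + 1).multichoose l : ℤ) := by
  rw [choose_neg_sub_one, choose_neg_sub_one, smul_mul_assoc, smul_mul_assoc]
  congr 1
  rw [Nat.multichoose_eq, show i + m + 1 + l - 1 = i + l + m by omega]
  have h1 := Nat.choose_mul (n := i + l + m) (k := i + l) (s := i) (by omega)
  have h2 := Nat.choose_mul (n := i + l + m) (k := i + m) (s := i) (by omega)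
  rw [← Nat.choose_symm_of_eq_add (show i + l + m = m + (i + l) by ring),
    show i + l + m - i = l + m by omega, show i + l - i = l by omega,
    ← Nat.choose_symm_of_eq_add (show l + m = m + l by ring)] at h1
  rw [← Nat.choose_symm_of_eq_add (show i + l + m = l + (i + m) by ring),
    show i + l + m - i = l + m by omega, show i + m - i = m by omega, ← h1, mul_comm,
    ← Nat.choose_symm_of_eq_add (show i + m = m + i by ring)] at h2
  exact_mod_cast h2.symm

/-- A trinomial revision that produces the coefficients of (x₂+x₀)^{-n-m-1} in the iterate. -/
lemma choose_mul_choose_neg (m n s : ℕ) :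
    ((m + s).choose m : ℤ) * Ring.choose (-(n : ℤ) - 1) (m + s)
      = Ring.choose (-(n : ℤ) - 1) m * Ring.choose (-((n + m + 1 : ℕ) : ℤ)) s := by
  have := Ring.choose_add_smul_choose (-((n + m + 1 : ℕ) : ℤ)) s m
  rw [show -((n + m + 1 : ℕ) : ℤ) + m = -(n : ℤ) - 1 by push_cast; ring, add_comm s m,
    nsmul_eq_mul] at this
  exact this

section Fock

variable {𝔥 : Type*} [AddCommGroup 𝔥] [Module ℂ 𝔥] (B : LinearMap.BilinForm ℂ 𝔥) (ℓ : ℂ)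

/-- The `L`-th partial sum of `∑ₛ (m + s choose m) a(-m-s-1/2) Xˢ`. -/
def creationSum (a : 𝔥) (m : ℕ) (X : Module.End ℂ (ℤ → ℤ → Fock B ℓ)) (L : ℕ) :
    Module.End ℂ (ℤ → ℤ → Fock B ℓ) :=
  ∑ s ∈ Finset.range L, (m + s).choose m •
    (mapCoeff (mode B ℓ a (-((m + s : ℕ) : ℤ) - 1)) * X ^ s)

lemma creationSum_apply (a : 𝔥) (m : ℕ) (X : Module.End ℂ (ℤ → ℤ → Fock B ℓ)) (L : ℕ)
    (f : ℤ → ℤ → Fock B ℓ) (c b : ℤ) : creationSum B ℓ a m X L f c b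
      = ∑ s ∈ Finset.range L, (m + s).choose m •
        mode B ℓ a (-((m + s : ℕ) : ℤ) - 1) ((X ^ s) f c b) := by
  rw [creationSum, LinearMap.sum_apply, Finset.sum_apply, Finset.sum_apply]
  rfl

lemma subst_creationSum (a : 𝔥) (m : ℕ) (L : ℕ) (N : ℤ) (f : ℤ → ℤ → Fock B ℓ) :
    subst N (creationSum B ℓ a m (shift 1 0) L f) = creationSum B ℓ a m mulAdd L (subst N f) := by
  have : subst N * creationSum B ℓ a m (shift 1 0) L
      = creationSum B ℓ a m mulAdd L * subst N := by
    rw [creationSum, creationSum, Finset.mul_sum, Finset.sum_mul]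
    refine Finset.sum_congr rfl fun s _ => ?_
    rw [mul_smul_comm, smul_mul_assoc, ← mul_assoc, (subst_mapCoeff N _).eq, mul_assoc,
      subst_mul_shift_pow, mul_assoc]
  exact LinearMap.congr_fun this f

lemma mulAdd_pow_creationSum (a : 𝔥) (m : ℕ) (L p : ℕ) (f : ℤ → ℤ → Fock B ℓ) :
    (mulAdd ^ p) (creationSum B ℓ a m mulAdd L f)
      = creationSum B ℓ a m mulAdd L ((mulAdd ^ p) f) := by
  have : Commute (mulAdd ^ p) (creationSum B ℓ a m mulAdd L) := by
    refine Commute.sum_right _ _ _ fun s _ => (Commute.smul_right ?_ _)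
    exact ((mulAdd_commute_mapCoeff _).mul_right ((Commute.refl _).pow_right s)).pow_left p
  exact LinearMap.congr_fun this f

/-- The series `Y(u₁, x₁) Y(u₂, x₂) v`. -/
def productTwo (u₁ u₂ v : Fock B ℓ) : ℤ → ℤ → Fock B ℓ := fun c b =>
  vertexOp B ℓ u₁ (vertexOp B ℓ u₂ v b) c

/-- The recursion for the outer operator, followed by `mode_vertexOp` to move a(n+1/2) past
Y(u₂,x₂). The creation part is infinite as a series and finite in each coefficient, which is why it
appears as a limit of partial sums. -/
lemma productTwo_stabilizes (a : 𝔥) (m : ℕ) (u u₂ v : Fock B ℓ) (N : ℤ) (K K' : ℕ)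
    (hN : ∀ i : ℕ, ∀ b ≤ N, vertexOp B ℓ (mode B ℓ a i u₂) v b = 0)
    (hK : ∀ n : ℕ, K ≤ n → mode B ℓ a n v = 0) (hK' : ∀ n : ℕ, K' ≤ n → mode B ℓ a n u₂ = 0) :
    Stabilizes (fun L => creationSum B ℓ a m (shift 1 0) L (productTwo B ℓ u u₂ v)
      + ∑ n ∈ Finset.range K, Ring.choose (-(n : ℤ) - 1) m • shift (-((n + m + 1 : ℕ) : ℤ)) 0
        (productTwo B ℓ (parity B ℓ u) (parity B ℓ u₂) (mode B ℓ a n v))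
      + ∑ i ∈ Finset.range K', Ring.choose (-(i : ℤ) - 1) m • divSub N (i + m + 1)
        (productTwo B ℓ (parity B ℓ u) (mode B ℓ a i u₂) v))
      (productTwo B ℓ (mode B ℓ a (-(m : ℤ) - 1) u) u₂ v) := by
  intro c b
  have hdiag := eventually_sum_diag (fun i l => (Ring.choose (-((i + l : ℕ) : ℤ) - 1) m
      * ((i + l).choose i : ℤ)) • productTwo B ℓ (parity B ℓ u) (mode B ℓ a i u₂) v
      (c + i + l + m + 1) (b - l)) K' (b - N).toNat
    (fun i l hi => by simp [productTwo, hK' i hi])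
    (fun i l _ hl => by simp [productTwo, hN i (b - l) (by omega)])
  filter_upwards [vertexOp_mode B ℓ a m u (vertexOp B ℓ u₂ v b) c, hdiag,
    Filter.eventually_ge_atTop K] with L hL hdiag hLK
  -- The commutator terms carry x₂^{n-i}; putting l = n - i arranges them along diagonals, ready to
  -- be summed over l for each fixed i.
  have e1 : ∀ n : ℕ, Ring.choose (-(n : ℤ) - 1) m •
        vertexOp B ℓ (parity B ℓ u) (mode B ℓ a n (vertexOp B ℓ u₂ v b)) (c + n + m + 1)
      = Ring.choose (-(n : ℤ) - 1) m • shift (-((n + m + 1 : ℕ) : ℤ)) 0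
        (productTwo B ℓ (parity B ℓ u) (parity B ℓ u₂) (mode B ℓ a n v)) c b
      + ∑ i ∈ Finset.range (n + 1), (Ring.choose (-((i + (n - i) : ℕ) : ℤ) - 1) m
      * ((i + (n - i)).choose i : ℤ)) • productTwo B ℓ (parity B ℓ u) (mode B ℓ a i u₂) v
      (c + i + (n - i : ℕ) + m + 1) (b - (n - i : ℕ)) := fun n => by
    rw [mode_vertexOp, map_add, Pi.add_apply, smul_add, shift_apply, productTwo, sub_neg_eq_add,
      sub_zero, show c + ((n + m + 1 : ℕ) : ℤ) = c + n + m + 1 by push_cast; ring, map_sum,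
      Finset.sum_apply, Finset.smul_sum]
    congr 1
    refine Finset.sum_congr rfl fun i hi => ?_
    have hi' : i ≤ n := Nat.lt_succ_iff.1 (Finset.mem_range.1 hi)
    rw [Nat.add_sub_cancel' hi', Nat.cast_sub hi', productTwo, map_nsmul, Pi.smul_apply, mul_smul,
      natCast_zsmul, show c + i + ((n : ℤ) - i) + m + 1 = c + n + m + 1 by ring,
      show b - ((n : ℤ) - i) = b - n + i by ring]
  rw [productTwo, hL, Pi.add_apply, Pi.add_apply, Pi.add_apply, Pi.add_apply, creationSum_apply,
    add_assoc]
  congr 1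
  · refine Finset.sum_congr rfl fun s _ => ?_
    rw [shift_pow, shift_apply]
    simp [productTwo]
  · rw [Finset.sum_congr rfl fun n _ => e1 n, Finset.sum_add_distrib, hdiag]
    simp only [Finset.sum_apply, Pi.smul_apply]
    congr 1
    · refine (Finset.sum_subset (Finset.range_mono hLK) fun n _ hn => ?_).symm
      rw [shift_apply, productTwo, hK n (by simpa using hn)]
      simp
    · refine Finset.sum_congr rfl fun i _ => ?_
      rw [divSub, Finset.smul_sum]
      refine Finset.sum_congr rfl fun l _ => ?_
      rw [choose_neg_mul_choose, mul_smul, natCast_zsmul,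
        show c + i + l + m + 1 = c + ((i + m + 1 : ℕ) : ℤ) + l by push_cast; ring]

/-- The recursion is used twice: for the inner Y(·,x₀)u₂, and then, with m + s in place of m, for
the outer operator of each creation term. The powers x₀^s x₂^t collect into powers of x₀+x₂. -/
lemma iterateSeries_stabilizes (a : 𝔥) (m : ℕ) (u u₂ v : Fock B ℓ) (M : ℤ) (K K' : ℕ)
    (hM : ∀ b ≤ M, vertexOp B ℓ u u₂ b = 0)
    (hK : ∀ n : ℕ, K ≤ n → mode B ℓ a n v = 0) (hK' : ∀ n : ℕ, K' ≤ n → mode B ℓ a n u₂ = 0) :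
    Stabilizes (fun L => creationSum B ℓ a m mulAdd L (iterateSeries (vertexOp B ℓ) u u₂ v)
      + ∑ n ∈ Finset.range K, Ring.choose (-(n : ℤ) - 1) m • divAdd M (n + m + 1)
        (iterateSeries (vertexOp B ℓ) (parity B ℓ u) (parity B ℓ u₂) (mode B ℓ a n v))
      + ∑ i ∈ Finset.range K', Ring.choose (-(i : ℤ) - 1) m • shift (-((i + m + 1 : ℕ) : ℤ)) 0
        (iterateSeries (vertexOp B ℓ) (parity B ℓ u) (mode B ℓ a i u₂) v))
      (iterateSeries (vertexOp B ℓ) (mode B ℓ a (-(m : ℤ) - 1) u) u₂ v) := by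
  intro α β
  set S := (α - M).toNat with hS
  have hw : ∀ s : ℕ, S ≤ s → vertexOp B ℓ u u₂ (α - s) = 0 := fun s hs => hM _ (by omega)
  -- A uniform truncation bound exists because only the finitely many s < S give a nonzero inner
  -- coefficient.
  obtain ⟨R, hR⟩ : ∃ R : ℕ, ∀ t, R ≤ t → ∀ s ∈ Finset.range S,
      vertexOp B ℓ (vertexOp B ℓ u u₂ (α - s)) v (β - t) = 0 :=
    Filter.eventually_atTop.1 ((Filter.eventually_all_finset _).2 fun s _ =>
      eventually_vertexOp_eq_zero B ℓ _ v β)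
  have hfirst : vertexOp B ℓ (mode B ℓ a (-(m : ℤ) - 1) u) u₂ α
      = ∑ s ∈ Finset.range S, (m + s).choose m •
          mode B ℓ a (-((m + s : ℕ) : ℤ) - 1) (vertexOp B ℓ u u₂ (α - s))
        + ∑ i ∈ Finset.range K', Ring.choose (-(i : ℤ) - 1) m •
          vertexOp B ℓ (parity B ℓ u) (mode B ℓ a i u₂) (α + i + m + 1) := by
    obtain ⟨L, hL, hLS⟩ := ((vertexOp_mode B ℓ a m u u₂ α).and
      (Filter.eventually_ge_atTop (S + K'))).exists
    rw [hL]
    congr 1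
    · refine (Finset.sum_subset (Finset.range_mono (by omega)) fun s _ hs => ?_).symm
      rw [hw s (by simpa using hs), map_zero, smul_zero]
    · refine (Finset.sum_subset (Finset.range_mono (by omega)) fun i _ hi => ?_).symm
      rw [hK' i (by simpa using hi), map_zero, Pi.zero_apply, smul_zero]
  have hdiag := eventually_sum_diag (fun s t => ((m + (s + t)).choose m * (s + t).choose s) •
      mode B ℓ a (-((m + (s + t) : ℕ) : ℤ) - 1)
        (vertexOp B ℓ (vertexOp B ℓ u u₂ (α - s)) v (β - t))) S R
    (fun s t hs => by simp [hw s hs])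
    (fun s t hs ht => by simp [hR t ht s (Finset.mem_range.2 hs)])
  filter_upwards [(Filter.eventually_all_finset (Finset.range S)).2 fun s _ =>
    vertexOp_mode B ℓ a (m + s) (vertexOp B ℓ u u₂ (α - s)) v β, hdiag,
    Filter.eventually_ge_atTop (K + R)] with L hL hdiag hLK
  rw [iterateSeries, hfirst, map_add, LinearMap.add_apply, Pi.add_apply, Pi.add_apply,
    Pi.add_apply, Pi.add_apply, Pi.add_apply, creationSum_apply, map_sum, map_sum,
    LinearMap.sum_apply, LinearMap.sum_apply, Finset.sum_apply, Finset.sum_apply]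
  congr 1
  · have e1 : ∀ j : ℕ, (m + j).choose m • mode B ℓ a (-((m + j : ℕ) : ℤ) - 1)
          ((mulAdd ^ j) (iterateSeries (vertexOp B ℓ) u u₂ v) α β)
        = ∑ s ∈ Finset.range (j + 1), ((m + (s + (j - s))).choose m * (s + (j - s)).choose s) •
          mode B ℓ a (-((m + (s + (j - s)) : ℕ) : ℤ) - 1)
            (vertexOp B ℓ (vertexOp B ℓ u u₂ (α - s)) v (β - (j - s : ℕ))) := fun j => by
      rw [mulAdd_pow_apply, map_sum, Finset.smul_sum]
      refine Finset.sum_congr rfl fun s hs => ?_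
      rw [Nat.add_sub_cancel' (Nat.lt_succ_iff.1 (Finset.mem_range.1 hs)), map_nsmul, smul_smul]
      rfl
    rw [Finset.sum_congr rfl fun j _ => e1 j, hdiag]
    simp only [Finset.sum_apply, Pi.smul_apply, divAdd, Finset.smul_sum]
    rw [Finset.sum_comm (s := Finset.range K), ← Finset.sum_add_distrib]
    refine Finset.sum_congr rfl fun s hs => ?_
    rw [map_nsmul, LinearMap.smul_apply, Pi.smul_apply, hL s hs, smul_add, Finset.smul_sum,
      Finset.smul_sum]
    congr 1
    · refine (Finset.sum_subset (Finset.range_mono (by omega)) fun t _ ht => ?_).symm.trans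
        (Finset.sum_congr rfl fun t _ => ?_)
      · rw [hR t (by simpa using ht) s hs, map_zero, smul_zero, smul_zero]
      · rw [smul_smul, ← add_assoc m s t]
        congr 1
        have := Nat.choose_mul (n := m + s + t) (k := m + s) (s := m) (by omega)
        rw [show m + s + t - m = s + t by omega, show m + s - m = s by omega] at this
        rw [← this, mul_comm]
    · refine (Finset.sum_subset (Finset.range_mono (by omega)) fun n _ hn => ?_).symm.trans
        (Finset.sum_congr rfl fun n _ => ?_)
      · rw [hK n (by simpa using hn), map_zero, Pi.zero_apply, smul_zero, smul_zero]
      · rw [← natCast_zsmul, smul_smul, smul_smul, choose_mul_choose_neg, parity_vertexOp,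
          iterateSeries,
          show β + n + ((m + s : ℕ) : ℤ) + 1 = β + ((n + m + 1 : ℕ) : ℤ) + s by push_cast; ring]
  · simp only [Finset.sum_apply, Pi.smul_apply]
    refine Finset.sum_congr rfl fun i _ => ?_
    rw [map_zsmul, LinearMap.smul_apply, Pi.smul_apply, shift_apply, iterateSeries, sub_neg_eq_add,
      sub_zero, show α + ((i + m + 1 : ℕ) : ℤ) = α + i + m + 1 by push_cast; ring]

end Fock

/-! ### Weak associativity by induction on the first vector -/

section Fock

variable {𝔥 : Type*} [AddCommGroup 𝔥] [Module ℂ 𝔥] (B : LinearMap.BilinForm ℂ 𝔥) (ℓ : ℂ)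

/-- Weak associativity for `u₁`, `v` with exponent `p`. -/
def AssocWith (u₁ v : Fock B ℓ) (p : ℕ) : Prop := ∀ u₂ : Fock B ℓ,
  (mulAdd ^ p) (productSeries (vertexOp B ℓ) u₁ u₂ v)
    = (mulAdd ^ p) (iterateSeries (vertexOp B ℓ) u₁ u₂ v)

variable {B ℓ} in
lemma AssocWith.mono {u₁ v : Fock B ℓ} {p q : ℕ} (h : AssocWith B ℓ u₁ v p) (hpq : p ≤ q) :
    AssocWith B ℓ u₁ v q := fun u₂ => by
  rw [← Nat.sub_add_cancel hpq, pow_add, Module.End.mul_apply, Module.End.mul_apply, h u₂]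

lemma exists_truncation (w v : Fock B ℓ) :
    ∀ᶠ N : ℤ in Filter.atBot, ∀ b ≤ N, vertexOp B ℓ w v b = 0 := by
  obtain ⟨M, hM⟩ := vertexOp_truncation B ℓ w v
  filter_upwards [Filter.eventually_lt_atBot M] with N hN b hb using hM b (by omega)

lemma productSeries_eq (u₁ u₂ v : Fock B ℓ) (N : ℤ) (hN : ∀ b ≤ N, vertexOp B ℓ u₂ v b = 0) :
    productSeries (vertexOp B ℓ) u₁ u₂ v = subst N (productTwo B ℓ u₁ u₂ v) :=
  productSeries_eq_subst _ _ _ _ N hN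

/-- The three families of the two expansions are matched one by one. The quantities K', N and M
depend on u₂ but do not enter the exponent. -/
lemma assocWith_mode (a : 𝔥) (m : ℕ) (u v : Fock B ℓ) (K r : ℕ)
    (hK : ∀ n : ℕ, K ≤ n → mode B ℓ a n v = 0) (hu : AssocWith B ℓ u v r)
    (hu' : AssocWith B ℓ (parity B ℓ u) v r)
    (hn : ∀ n < K, AssocWith B ℓ (parity B ℓ u) (mode B ℓ a n v) r) :
    AssocWith B ℓ (mode B ℓ a (-(m : ℤ) - 1) u) v (r + (K + m + 1)) := by
  intro u₂
  set p := r + (K + m + 1) with hp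
  obtain ⟨K', hK'⟩ := exists_mode_eq_zero B ℓ u₂
  obtain ⟨N, hN, hNi, hNn⟩ := ((exists_truncation B ℓ u₂ v).and
    (((Filter.eventually_all_finset (Finset.range K')).2 fun i _ =>
      exists_truncation B ℓ (mode B ℓ a i u₂) v).and
    ((Filter.eventually_all_finset (Finset.range K)).2 fun n _ =>
      exists_truncation B ℓ (parity B ℓ u₂) (mode B ℓ a n v)))).exists
  obtain ⟨M, hM⟩ := (exists_truncation B ℓ u u₂).exists
  have hNi' : ∀ i : ℕ, ∀ b ≤ N, vertexOp B ℓ (mode B ℓ a i u₂) v b = 0 := fun i b hb => by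
    rcases lt_or_ge i K' with hi | hi
    · exact hNi i (Finset.mem_range.2 hi) b hb
    · rw [hK' a i hi]; simp
  -- Parity preserves the vanishing of coefficients, so the bound M for u and u₂ also serves their
  -- parity images, as clearing the pole in x₂+x₀ requires.
  have hM' : ∀ α ≤ M, ∀ (v : Fock B ℓ) (β : ℤ),
      iterateSeries (vertexOp B ℓ) (parity B ℓ u) (parity B ℓ u₂) v α β = 0 := fun α hα v β => by
    rw [iterateSeries, ← parity_vertexOp, hM α hα]
    simp
  have hP := ((productTwo_stabilizes B ℓ a m u u₂ v N K K' hNi' hK (hK' a)).subst N).mulAdd_pow p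
  have hI := (iterateSeries_stabilizes B ℓ a m u u₂ v M K K' hM hK (hK' a)).mulAdd_pow p
  rw [productSeries_eq B ℓ _ _ _ N hN]
  refine hP.unique ?_
  convert hI using 2 with L
  simp only [map_add, map_sum, map_zsmul]
  congr 1
  · congr 1
    · rw [subst_creationSum, mulAdd_pow_creationSum, mulAdd_pow_creationSum,
        ← productSeries_eq B ℓ _ _ _ N hN, hu.mono (show r ≤ p by omega) u₂]
    · refine Finset.sum_congr rfl fun n hnK => ?_
      have hnK' := Finset.mem_range.1 hnK
      congr 1
      -- The factor (x₀+x₂)^{n+m+1} clears the pole on both sides despite the opposite expansions, r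
      -- serves the induction hypothesis, and K - n is left over.
      rw [show p = (K - n) + (r + (n + m + 1)) by omega, pow_add, Module.End.mul_apply,
        Module.End.mul_apply, pow_add, Module.End.mul_apply, Module.End.mul_apply,
        mulAdd_pow_divAdd M _ _ fun α hα β => hM' α hα _ β, ← hn n hnK' (parity B ℓ u₂),
        productSeries_eq B ℓ _ _ _ N (hNn n hnK)]
      have := LinearMap.congr_fun (subst_mul_shift_pow (V := Fock B ℓ) N (n + m + 1))
        (shift (-((n + m + 1 : ℕ) : ℤ)) 0
          (productTwo B ℓ (parity B ℓ u) (parity B ℓ u₂) (mode B ℓ a n v)))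
      rw [Module.End.mul_apply, Module.End.mul_apply, shift_pow, shift_shift, mul_one, mul_zero,
        add_neg_cancel, add_zero, shift_zero, Module.End.one_apply] at this
      rw [← this]
  -- Here both sides carry the same monomial x₀^{-i-m-1}; no pole in x₀+x₂ has to be cleared, so r
  -- alone suffices.
  · refine Finset.sum_congr rfl fun i _ => ?_
    congr 1
    have hc := ((mulAdd_commute_shift (V := Fock B ℓ) (-((i + m + 1 : ℕ) : ℤ)) 0).pow_left p).eq
    rw [subst_divSub N _ _ fun c b hb => by rw [productTwo, hNi' i b hb]; simp,
      ← productSeries_eq B ℓ _ _ _ N (hNi' i), ← Module.End.mul_apply, ← Module.End.mul_apply, hc,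
      Module.End.mul_apply, Module.End.mul_apply, hu'.mono (show r ≤ p by omega) _]

theorem exists_assocWith (u₁ v : Fock B ℓ) : ∃ p, AssocWith B ℓ u₁ v p := by
  induction u₁ using fock_induction_parity generalizing v with
  | vac =>
    refine ⟨0, fun u₂ => ?_⟩
    obtain ⟨N, hN⟩ := (exists_truncation B ℓ u₂ v).exists
    congr 1
    refine funext fun a => funext fun b => ?_
    rw [productSeries_eq B ℓ _ _ _ N hN, subst_apply, iterateSeries, vertexOp_vac]
    split_ifs with ha
    · subst ha
      rcases le_or_gt b N with hb | hb
      · rw [Int.toNat_of_nonpos (by omega), hN b hb]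
        simp
      · rw [Finset.sum_eq_single 0]
        · simp [productTwo, vertexOp_vac]
        · intro i _ hi
          rw [productTwo, vertexOp_vac, if_neg (by omega), smul_zero]
        · intro h
          simp at h
          omega
    · rw [map_zero, LinearMap.zero_apply, Pi.zero_apply]
      refine Finset.sum_eq_zero fun i _ => ?_
      rw [productTwo, vertexOp_vac]
      -- Only a + i = 0 could contribute, with coefficient C(0,i); this vanishes since a ≠ 0 forces
      -- i > 0.
      split_ifs with hi
      · obtain ⟨j, rfl⟩ : ∃ j, i = j + 1 := ⟨i - 1, by omega⟩
        rw [hi, Ring.choose_zero_succ, zero_smul]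
      · rw [smul_zero]
  | mode a m u ih ih' =>
    obtain ⟨K, hK⟩ := exists_mode_eq_zero B ℓ v
    obtain ⟨p, hp⟩ := ih v
    obtain ⟨p', hp'⟩ := ih' v
    choose q hq using fun n : ℕ => ih' (mode B ℓ a n v)
    -- The sum is a common upper bound for the finitely many exponents required: those of u and its
    -- parity image at v, and of the latter at a(n+1/2)v for n < K.
    refine ⟨_, assocWith_mode B ℓ a m u v K (p + p' + ∑ n ∈ Finset.range K, q n) (hK a)
      (hp.mono (by omega)) (hp'.mono (by omega)) fun n hn => (hq n).mono ?_⟩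
    exact (Finset.single_le_sum (fun _ _ => Nat.zero_le _) (Finset.mem_range.2 hn)).trans
      (Nat.le_add_left _ _)
  | add u u' hu hu' =>
    obtain ⟨p, hp⟩ := hu v
    obtain ⟨p', hp'⟩ := hu' v
    refine ⟨p + p', fun u₂ => ?_⟩
    obtain ⟨N, hN⟩ := (exists_truncation B ℓ u₂ v).exists
    have h1 := hp.mono (Nat.le_add_right p p') u₂
    have h2 := hp'.mono (Nat.le_add_left p' p) u₂
    rw [productSeries_eq B ℓ _ _ _ N hN] at h1 h2 ⊢
    have e1 : productTwo B ℓ (u + u') u₂ v = productTwo B ℓ u u₂ v + productTwo B ℓ u' u₂ v := by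
      refine funext fun c => funext fun b => ?_
      simp [productTwo]
    have e2 : iterateSeries (vertexOp B ℓ) (u + u') u₂ v
        = iterateSeries (vertexOp B ℓ) u u₂ v + iterateSeries (vertexOp B ℓ) u' u₂ v := by
      refine funext fun c => funext fun b => ?_
      simp [iterateSeries]
    rw [e1, e2, map_add, map_add, map_add, h1, h2]
  | smul c u hu =>
    obtain ⟨p, hp⟩ := hu v
    refine ⟨p, fun u₂ => ?_⟩
    obtain ⟨N, hN⟩ := (exists_truncation B ℓ u₂ v).exists
    have h1 := hp u₂
    rw [productSeries_eq B ℓ _ _ _ N hN] at h1 ⊢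
    have e1 : productTwo B ℓ (c • u) u₂ v = c • productTwo B ℓ u u₂ v := by
      refine funext fun c => funext fun b => ?_
      simp [productTwo]
    have e2 : iterateSeries (vertexOp B ℓ) (c • u) u₂ v
        = c • iterateSeries (vertexOp B ℓ) u u₂ v := by
      refine funext fun c => funext fun b => ?_
      simp [iterateSeries]
    rw [e1, e2, map_smul, map_smul, map_smul, h1]

theorem isMOSVA_fock : IsMOSVA (weightSpace B ℓ) (vertexOp B ℓ) (vac B ℓ) where
  grading := isInternal_weightSpace B ℓ
  lower_bound := ⟨0, fun _ hk => weightSpace_eq_bot B ℓ hk⟩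
  truncation := vertexOp_truncation B ℓ
  d_commutator v w n := by
    rw [weightOp_vertexOp, Int.cast_smul_eq_zsmul]
    abel
  identity w := funext fun k => by
    rw [vertexOp_vac, Pi.single_apply]
  creation := vertexOp_creation B ℓ
  D_derivative v w := funext fun k => by
    rw [derivOp_eq, vertexOp_translation, formalDeriv]
  D_commutator v w k := by
    rw [derivOp_eq, derivOp_eq, translation_vertexOp, formalDeriv, add_sub_cancel_left]
  weak_associativity u v := by
    obtain ⟨p, hp⟩ := exists_assocWith B ℓ u v
    exact ⟨p, fun u₂ => by rw [mulAddPow_eq, mulAddPow_eq, hp u₂]⟩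

end Fock

end FermionicMOSVA
end

theorem mainTheorem1 {𝔥 : Type*} [AddCommGroup 𝔥] [Module ℂ 𝔥] [FiniteDimensional ℂ 𝔥]
    (M : ℕ) (hM : Module.finrank ℂ 𝔥 = 2 * M)
    (B : LinearMap.BilinForm ℂ 𝔥) (hB : B.IsSymm) (hB' : B.Nondegenerate)
    (𝔭 𝔮 : Submodule ℂ 𝔥) (h𝔭 : FermionicMOSVA.IsMaximalIsotropic B 𝔭)
    (h𝔮 : FermionicMOSVA.IsMaximalIsotropic B 𝔮) (h𝔭𝔮 : IsCompl 𝔭 𝔮) (ℓ : ℂ) :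
    FermionicMOSVA.IsMOSVA (FermionicMOSVA.weightSpace B ℓ) (FermionicMOSVA.vertexOp B ℓ)
      (FermionicMOSVA.vac B ℓ) := by
  exact FermionicMOSVA.isMOSVA_fock B ℓ
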